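/- Let $m,n\ge 1$ be coprime integers and $t>0$ real, with $(m,n,t)\neq(1,1,1)$. Let $D$ be the Bloch--Wigner dilogarithm and $$Q(x)=\frac{x^n-1}{x^m-1}\cdot\frac{x^{-n}-1}{x^{-m}-1}-t^2 .$$ Let $\alpha_1,\dots,\alpha_N$ be the different roots of $Q$ of odd multiplicity with $|\alpha_k|=1$ and $\operatorname{Im}\alpha_k>0$, ordered counterclockwise starting from the one closest to $1$. An admissible polygon of type $(m,n)$ is a closed polygon with $m+n$ sides inscribed in a circle, its vertices not all on one line, with $m$ sides of length $t$ and $n$ sides of length $1$, such that all the sides of length $t$ wind around the center of the circle in the same direction, and all the sides of length $1$ wind around the center in the same direction, which may be the opposite one (a side that is a diameter may be said to wind in either direction). Admissible polygons are considered up to rigid motions, up to the order of the sides, and up to the direction in which they are traversed. For such a $P\subset\mathbb C=\partial\mathbb H^3\setminus\{\infty\}$, let $\pi^*(P)$ be the ideal polyhedron in the upper half-space $\mathbb H^3$ with vertices $\infty$ and those of $P$. Its volume $\mathrm{Vol}(\pi^*(P))$ is the sum, over the $m+n$ sides of $P$, of the hyperbolic volumes of the tetrahedra that lie over the triangles spanned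 by the center and a side, and above the hemisphere over the circumscribed circle; the tetrahedra over the sides of length $t$ are counted negatively if the two families of sides wind in opposite directions. Then $Q$ has finitely many roots on the open upper half of the unit circle, there are finitely many admissible polygons of type $(m,n)$, and there is a bijection $\alpha\mapsto P_\alpha$ from these roots (of any multiplicity) to these polygons such that, when $P_\alpha$ is traversed in a suitable direction, the signed central angles of its sides of length $1$ are $\equiv m\arg\alpha$ and those of its sides of length $t$ are $\equiv -n\arg\alpha$ modulo $2\pi$, and such that $$\pm 2\,\mathrm{Vol}(\pi^*(P_\alpha))=m\,D(\alpha^n)-n\,D(\alpha^m).$$ Moreover, for each $\epsilon\in\{1,-1\}$, if $P_1,\dots,P_M$ are all the admissible polygons of type $(m,n)$, there are $\epsilon_k$ with $\epsilon_k=\pm1$ if the root corresponding to $P_k$ has odd multiplicity, and $\epsilon_k=0$ otherwise, such that $$\epsilon\sum_{k=1}^N(-1)^k\left(\frac{D(\alpha_k^n)}{n}-\frac{D(\alpha_k^m)}{m}\right)=\frac{2}{mn}\sum_{k=1}^M\epsilon_k\,\mathrm{Vol}(\pi^*(P_k)).$$ -/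

import Mathlib

noncomputable section

/-- The dilogarithm series `∑_{k ≥ 1} z ^ k / k ^ 2`, absolutely convergent for `‖z‖ ≤ 1`. -/
def dilogSeries (z : ℂ) : ℂ := ∑' k : ℕ, z ^ (k + 1) / ((k : ℂ) + 1) ^ 2

/-- The formula `Im (Li₂ z) + log |z| * arg (1 - z)` on the closed unit disc. -/
def blochWignerDisc (z : ℂ) : ℝ :=
  (dilogSeries z).im + Real.log ‖z‖ * Complex.arg (1 - z)

/-- The Bloch-Wigner dilogarithm `D`, on all of `ℂ`. Outside of the closed unit disc, the
continuous extension of the formula on the disc is given by `D z = - D (1 / z)`. -/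
def blochWigner (z : ℂ) : ℝ :=
  if ‖z‖ ≤ 1 then blochWignerDisc z else - blochWignerDisc z⁻¹

/-- The rational function
`Q x = (x ^ n - 1) / (x ^ m - 1) * ((x ^ (-n) - 1) / (x ^ (-m) - 1)) - t ^ 2`.
For coprime `m`, `n` and `t ≠ 0`, a pole of `Q` on the unit circle other than `1` is a point where
`x ^ m = 1`, and there Lean's value is `- t ^ 2 ≠ 0`, so poles are not mistaken for roots. -/
def ratQ (m n : ℕ) (t : ℝ) (x : ℂ) : ℂ :=
  (x ^ n - 1) / (x ^ m - 1) * (((x⁻¹) ^ n - 1) / ((x⁻¹) ^ m - 1)) - (t : ℂ) ^ 2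

/-- The roots of `Q` on the open upper half of the unit circle. -/
def upperUnitRoots (m n : ℕ) (t : ℝ) : Set ℂ :=
  {x | ‖x‖ = 1 ∧ 0 < x.im ∧ ratQ m n t x = 0}

/-- The roots of `Q` of odd multiplicity on the open upper half of the unit circle. -/
def oddUpperUnitRoots (m n : ℕ) (t : ℝ) : Set ℂ :=
  {x | x ∈ upperUnitRoots m n t ∧ Odd (analyticOrderNatAt (ratQ m n t) x)}

/-- For a closed polygon with vertices `v 0, v 1, …` on a circle with center `c`, the factor
`exp (i ω)`, where `ω` is the signed central angle of the side from `v i` to the next vertex. -/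
def sideTurn {N : ℕ} (c : ℂ) (v : Fin N → ℂ) (i : Fin N) : ℂ :=
  (v (finRotate N i) - c) / (v i - c)

/-- An admissible polygon of type `(m, n)`: a closed cyclic polygon with `m + n` sides, side `i`
going from `vertex i` to the cyclically next vertex; `m` sides (those in `longSides`) have length
`t`, the other `n` sides have length `1`. All the sides of length `t` wind around the center in the
same direction, and so do all the sides of length `1`. A side that is a diameter
(`(sideTurn center vertex i).im = 0`) may be said to wind in either direction. -/
structure AdmissiblePolygon (m n : ℕ) (t : ℝ) where
  center : ℂ
  radius : ℝ
  vertex : Fin (m + n) → ℂ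
  longSides : Finset (Fin (m + n))
  radius_pos : 0 < radius
  cyclic : ∀ i, ‖vertex i - center‖ = radius
  card_long : longSides.card = m
  length_long : ∀ i ∈ longSides, ‖vertex (finRotate (m + n) i) - vertex i‖ = t
  length_short : ∀ i ∉ longSides, ‖vertex (finRotate (m + n) i) - vertex i‖ = 1
  direction_long : (∀ i ∈ longSides, 0 ≤ (sideTurn center vertex i).im) ∨
    (∀ i ∈ longSides, (sideTurn center vertex i).im ≤ 0)
  direction_short : (∀ i ∉ longSides, 0 ≤ (sideTurn center vertex i).im) ∨
    (∀ i ∉ longSides, (sideTurn center vertex i).im ≤ 0)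
  not_collinear : ¬ Collinear ℝ (Set.range vertex)

/-- The volume of a region of hyperbolic space in the upper half-space model `ℂ × ℝ_{>0}`,
with volume form `dx dy dh / h ^ 3`. -/
def hyperbolicVolume (A : Set (ℂ × ℝ)) : ℝ :=
  (∫⁻ p in A ∩ {p | 0 < p.2}, ENNReal.ofReal (1 / p.2 ^ 3)).toReal

namespace AdmissiblePolygon

variable {m n : ℕ} {t : ℝ}

/-- The factor `exp (i ω)` for the signed central angle `ω` of side `i`. -/
def turn (P : AdmissiblePolygon m n t) (i : Fin (m + n)) : ℂ := sideTurn P.center P.vertex i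

/-- Two admissible polygons are the same up to rigid motions (and the direction in which the
polygon is traversed) and up to the order of the sides: they have the same radius, and for some
matching of the sides that respects their two kinds, the signed central angles agree, possibly
after changing the sign of all of them at once. -/
def Equivalent (P P' : AdmissiblePolygon m n t) : Prop :=
  P.radius = P'.radius ∧
  ∃ e : Fin (m + n) ≃ Fin (m + n), (∀ i, i ∈ P.longSides ↔ e i ∈ P'.longSides) ∧
    ((∀ i, P'.turn (e i) = P.turn i) ∨ (∀ i, P'.turn (e i) = starRingEnd ℂ (P.turn i)))

theorem equivalent_equivalence : Equivalence (Equivalent (m := m) (n := n) (t := t)) where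
  refl P := ⟨rfl, Equiv.refl _, fun _ => Iff.rfl, Or.inl fun _ => rfl⟩
  symm := by
    rintro P P' ⟨hr, e, he, h⟩
    refine ⟨hr.symm, e.symm, fun i => by rw [he]; simp, ?_⟩
    rcases h with h | h
    · exact Or.inl fun i => by rw [← h]; simp
    · refine Or.inr fun i => ?_
      have := h (e.symm i)
      rw [Equiv.apply_symm_apply] at this
      rw [this, Complex.conj_conj]
  trans := by
    rintro P P' P'' ⟨hr, e, he, h⟩ ⟨hr', e', he', h'⟩
    refine ⟨hr.trans hr', e.trans e', fun i => by rw [he, he']; rfl, ?_⟩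
    rcases h with h | h <;> rcases h' with h' | h'
    · exact Or.inl fun i => by rw [Equiv.trans_apply, h', h]
    · exact Or.inr fun i => by rw [Equiv.trans_apply, h', h]
    · exact Or.inr fun i => by rw [Equiv.trans_apply, h', h]
    · exact Or.inl fun i => by rw [Equiv.trans_apply, h', h, Complex.conj_conj]

/-- The set of admissible polygons of type `(m, n)` modulo `Equivalent` is `Quotient (setoid m n t)`.
-/
def setoid (m n : ℕ) (t : ℝ) : Setoid (AdmissiblePolygon m n t) :=
  ⟨Equivalent, equivalent_equivalence⟩

/-- The hyperbolic tetrahedron over the triangle with vertices at the center and at the ends of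
side `i`: the part of the vertical prism over the triangle that lies on or above the hemisphere
over the circumscribed circle. Its vertices are `∞`, the two ends of the side, and the top of the
hemisphere. -/
def tetrahedron (P : AdmissiblePolygon m n t) (i : Fin (m + n)) : Set (ℂ × ℝ) :=
  {p | p.1 ∈ convexHull ℝ {P.center, P.vertex i, P.vertex (finRotate (m + n) i)} ∧
    P.radius ^ 2 ≤ ‖p.1 - P.center‖ ^ 2 + p.2 ^ 2 ∧ 0 < p.2}

/-- The sides of length `t` wind in the direction opposite to that of the sides of length `1`. -/
def OppositeDirections (P : AdmissiblePolygon m n t) : Prop :=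
  ∃ i ∈ P.longSides, ∃ j ∉ P.longSides, (P.turn i).im * (P.turn j).im < 0

open Classical in
/-- The hyperbolic volume `Vol (π^* P)` of the ideal polyhedron over `P` with apex `∞`: the sum of
the volumes of the tetrahedra over the sides, those over the sides of length `t` being counted
negatively if the two families of sides wind in opposite directions. -/
def polyhedronVolume (P : AdmissiblePolygon m n t) : ℝ :=
  (∑ j ∈ P.longSidesᶜ, hyperbolicVolume (P.tetrahedron j)) +
    (if P.OppositeDirections then -1 else 1) *
      ∑ i ∈ P.longSides, hyperbolicVolume (P.tetrahedron i)

/-- With `x = exp (i σ)`: the signed central angles of the sides of length `1` are `m σ`, and those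
of the sides of length `t` are `- n σ` modulo `2 π`, for one of the two directions in which the
polygon may be traversed. -/
def CorrespondsTo (P : AdmissiblePolygon m n t) (x : ℂ) : Prop :=
  ((∀ j ∉ P.longSides, P.turn j = x ^ m) ∧ (∀ i ∈ P.longSides, P.turn i = (x ^ n)⁻¹)) ∨
  ((∀ j ∉ P.longSides, P.turn j = (x ^ m)⁻¹) ∧ (∀ i ∈ P.longSides, P.turn i = x ^ n))

end AdmissiblePolygon

end

section

open ComplexConjugate

theorem Complex.eq_of_norm_sub_one_eq {z w : ℂ} (hz : ‖z‖ = 1) (hw : ‖w‖ = 1)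
    (h : ‖z - 1‖ = ‖w - 1‖) (him : 0 ≤ z.im * w.im) : z = w := by
  have key : ∀ y : ℂ, ‖y‖ ^ 2 = y.re ^ 2 + y.im ^ 2 := fun y => by
    rw [Complex.sq_norm, Complex.normSq_apply]; ring
  have h1 := key z
  have h2 := key w
  have h3 := key (z - 1)
  have h4 := key (w - 1)
  rw [hz] at h1; rw [hw] at h2; rw [h] at h3
  simp only [Complex.sub_re, Complex.one_re, Complex.sub_im, Complex.one_im] at h3 h4
  have hre : z.re = w.re := by nlinarith
  have him2 : (z.im - w.im) * (z.im + w.im) = 0 := by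
    rw [hre] at h1; nlinarith
  refine Complex.ext hre ?_
  rcases mul_eq_zero.1 him2 with h | h
  · linarith
  · have : z.im = - w.im := by linarith
    rw [this] at him ⊢
    have : w.im = 0 := by nlinarith [sq_nonneg w.im]
    rw [this]; simp

theorem Complex.sq_eq_one_of_norm_eq_one_of_im_eq_zero {x : ℂ} (hx : ‖x‖ = 1) (h : x.im = 0) :
    x ^ 2 = 1 := by
  have h1 : x * conj x = 1 := by rw [Complex.mul_conj, Complex.normSq_eq_norm_sq, hx]; simp
  rwa [Complex.conj_eq_iff_im.2 h, ← sq] at h1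

theorem eq_one_of_pow_eq_one_of_coprime {x : ℂ} {m n : ℕ} (hmn : m.Coprime n)
    (h1 : x ^ m = 1) (h2 : x ^ n = 1) : x = 1 := by
  simpa [hmn.gcd_eq_one] using pow_gcd_eq_one.2 ⟨h1, h2⟩

theorem eq_of_pow_eq_pow_of_coprime {x y : ℂ} {m n : ℕ} (hmn : m.Coprime n) (hy : y ≠ 0)
    (h1 : x ^ m = y ^ m) (h2 : x ^ n = y ^ n) : x = y := by
  have : x / y = 1 := eq_one_of_pow_eq_one_of_coprime hmn
    (by rw [div_pow, h1, div_self (pow_ne_zero _ hy)])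
    (by rw [div_pow, h2, div_self (pow_ne_zero _ hy)])
  rwa [div_eq_one_iff_eq hy] at this

theorem finRotate_mk_of_lt {N k : ℕ} (hk : k + 1 < N) :
    finRotate N ⟨k, by omega⟩ = ⟨k + 1, hk⟩ := by
  cases N with
  | zero => omega
  | succ N => exact finRotate_of_lt (by omega)

theorem ratQ_eq_zero_iff {m n : ℕ} {t : ℝ} (ht : 0 < t) {x : ℂ} (hx : ‖x‖ = 1) :
    ratQ m n t x = 0 ↔ ‖x ^ n - 1‖ / ‖x ^ m - 1‖ = t := by
  have h1 : ((x⁻¹) ^ n - 1) / ((x⁻¹) ^ m - 1) = conj ((x ^ n - 1) / (x ^ m - 1)) := by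
    rw [Complex.inv_eq_conj hx]; simp
  rw [ratQ, h1, Complex.mul_conj, Complex.normSq_eq_norm_sq, sub_eq_zero, norm_div]
  norm_cast
  exact pow_left_inj₀ (by positivity) ht.le two_ne_zero

variable {m n : ℕ} {t : ℝ} {x : ℂ}

theorem upperUnitRoots.norm_div_eq (ht : 0 < t) (hx : x ∈ upperUnitRoots m n t) :
    ‖x ^ n - 1‖ / ‖x ^ m - 1‖ = t := (ratQ_eq_zero_iff ht hx.1).1 hx.2.2

theorem upperUnitRoots.norm_pow_sub_one_pos (ht : 0 < t) (hx : x ∈ upperUnitRoots m n t) :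
    0 < ‖x ^ m - 1‖ := by
  have h := norm_div_eq ht hx
  rcases (norm_nonneg (x ^ m - 1)).eq_or_lt with h0 | h0
  · rw [← h0, div_zero] at h; exact absurd h ht.ne
  · exact h0

theorem upperUnitRoots.ne_zero (hx : x ∈ upperUnitRoots m n t) : x ≠ 0 := by
  rintro rfl; simpa using hx.1

theorem upperUnitRoots.sq_ne_one (hx : x ∈ upperUnitRoots m n t) : x ^ 2 ≠ 1 := by
  intro h
  have := hx.2.1
  rcases mul_self_eq_one_iff.1 (sq x ▸ h) with rfl | rfl <;> simp at this

theorem upperUnitRoots.one_lt_add (hm : 0 < m) (hn : 0 < n) (ht : 0 < t)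
    (hne : ¬ (m = 1 ∧ n = 1 ∧ t = 1)) (hx : x ∈ upperUnitRoots m n t) : 1 < m ∨ 1 < n := by
  by_contra! h
  obtain rfl : m = 1 := by omega
  obtain rfl : n = 1 := by omega
  have h1 := norm_div_eq ht hx
  rw [div_self (norm_pow_sub_one_pos ht hx).ne'] at h1
  exact hne ⟨rfl, rfl, h1.symm⟩

open Polynomial in
theorem finite_upperUnitRoots (hm : 0 < m) (hn : 0 < n) (hmn : Nat.Coprime m n) (ht : 0 < t)
    (hne : ¬ (m = 1 ∧ n = 1 ∧ t = 1)) : (upperUnitRoots m n t).Finite := by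
  rcases eq_or_ne m n with rfl | hmn'
  · have h1 : m = 1 := by simpa using hmn
    subst h1
    convert Set.finite_empty
    refine Set.eq_empty_of_forall_notMem fun x hx => ?_
    have := upperUnitRoots.one_lt_add hm hn ht hne hx
    omega
  set p : ℂ[X] := X ^ m * (X ^ n - C 1) ^ 2
  set q : ℂ[X] := C ((t : ℂ) ^ 2) * (X ^ n * (X ^ m - C 1) ^ 2)
  have ht' : ((t : ℂ) ^ 2) ≠ 0 := by simpa using ht.ne'
  have hp : p.natDegree = m + 2 * n := by
    rw [natDegree_mul (pow_ne_zero _ X_ne_zero)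
      (pow_ne_zero _ (X_pow_sub_C_ne_zero hn _)), natDegree_pow, natDegree_pow,
      natDegree_X_pow_sub_C, natDegree_X]; ring
  have hq : q.natDegree = n + 2 * m := by
    rw [natDegree_C_mul ht', natDegree_mul (pow_ne_zero _ X_ne_zero)
      (pow_ne_zero _ (X_pow_sub_C_ne_zero hm _)), natDegree_pow, natDegree_pow,
      natDegree_X_pow_sub_C, natDegree_X]; ring
  have hpq : p - q ≠ 0 := by
    intro h
    rw [sub_eq_zero.1 h, hq] at hp
    omega
  refine (p - q).roots.toFinset.finite_toSet.subset fun x hx => ?_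
  simp only [Finset.mem_coe, Multiset.mem_toFinset, mem_roots hpq, IsRoot, eval_sub]
  have hm0 : x ^ m - 1 ≠ 0 := norm_pos_iff.1 (upperUnitRoots.norm_pow_sub_one_pos ht hx)
  have hx0 := upperUnitRoots.ne_zero hx
  have h := hx.2.2
  have hm1 : 1 - x ^ m ≠ 0 := fun h => hm0 (by linear_combination -h)
  have hinv : ∀ k : ℕ, x⁻¹ ^ k - 1 = (1 - x ^ k) / x ^ k := fun k => by
    rw [inv_pow, sub_div, div_self (pow_ne_zero _ hx0), one_div]
  rw [ratQ, hinv, hinv] at h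
  field_simp at h
  simp only [p, q, eval_mul, eval_pow, eval_sub, eval_X, eval_C]
  linear_combination (-1 : ℂ) * h

namespace AdmissiblePolygon

variable (P : AdmissiblePolygon m n t)

theorem vertex_sub_ne_zero (i : Fin (m + n)) : P.vertex i - P.center ≠ 0 := by
  rw [← norm_pos_iff, P.cyclic]; exact P.radius_pos

theorem norm_turn (i : Fin (m + n)) : ‖P.turn i‖ = 1 := by
  rw [turn, sideTurn, norm_div, P.cyclic, P.cyclic, div_self P.radius_pos.ne']

theorem norm_turn_sub_one (i : Fin (m + n)) :
    ‖P.turn i - 1‖ = ‖P.vertex (finRotate (m + n) i) - P.vertex i‖ / P.radius := by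
  rw [turn, sideTurn, div_sub_one (P.vertex_sub_ne_zero i), norm_div, P.cyclic]
  congr 2; ring

theorem prod_turn : ∏ i, P.turn i = 1 := by
  simp only [turn, sideTurn, Finset.prod_div_distrib]
  rw [Equiv.prod_comp (finRotate (m + n)) fun i => P.vertex i - P.center]
  exact div_self (Finset.prod_ne_zero_iff.2 fun i _ => P.vertex_sub_ne_zero i)

theorem exists_mem_longSides (hm : 0 < m) : ∃ i, i ∈ P.longSides :=
  Finset.card_pos.1 (by rw [P.card_long]; exact hm)

theorem card_compl_longSides : P.longSidesᶜ.card = n := by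
  rw [Finset.card_compl, P.card_long]; simp

theorem exists_notMem_longSides (hn : 0 < n) : ∃ i, i ∉ P.longSides := by
  obtain ⟨i, hi⟩ := Finset.card_pos.1 (P.card_compl_longSides ▸ hn)
  exact ⟨i, Finset.mem_compl.1 hi⟩

theorem turn_eq_of_mem {i j : Fin (m + n)} (hi : i ∈ P.longSides) (hj : j ∈ P.longSides) :
    P.turn i = P.turn j := by
  refine Complex.eq_of_norm_sub_one_eq (P.norm_turn i) (P.norm_turn j) ?_ ?_
  · rw [norm_turn_sub_one, norm_turn_sub_one, P.length_long i hi, P.length_long j hj]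
  · rcases P.direction_long with h | h
    · exact mul_nonneg (h i hi) (h j hj)
    · exact mul_nonneg_of_nonpos_of_nonpos (h i hi) (h j hj)

theorem turn_eq_of_notMem {i j : Fin (m + n)} (hi : i ∉ P.longSides) (hj : j ∉ P.longSides) :
    P.turn i = P.turn j := by
  refine Complex.eq_of_norm_sub_one_eq (P.norm_turn i) (P.norm_turn j) ?_ ?_
  · rw [norm_turn_sub_one, norm_turn_sub_one, P.length_short i hi, P.length_short j hj]
  · rcases P.direction_short with h | h
    · exact mul_nonneg (h i hi) (h j hj)
    · exact mul_nonneg_of_nonpos_of_nonpos (h i hi) (h j hj)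

theorem exists_turn_ne_neg_one (hm : 0 < m) : ∃ i, P.turn i ≠ -1 := by
  by_contra! h
  have hN : 0 < m + n := by omega
  have key : ∀ k (hk : k < m + n), P.vertex ⟨k, hk⟩ = P.vertex ⟨0, hN⟩ ∨
      P.vertex ⟨k, hk⟩ = 2 * P.center - P.vertex ⟨0, hN⟩ := by
    intro k
    induction k with
    | zero => exact fun _ => Or.inl rfl
    | succ k ih =>
      intro hk
      have h1 := h ⟨k, by omega⟩
      rw [turn, sideTurn, finRotate_mk_of_lt hk, div_eq_iff (P.vertex_sub_ne_zero _)] at h1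
      rcases ih (by omega) with h3 | h3
      · right; rw [h3] at h1; linear_combination h1
      · left; rw [h3] at h1; linear_combination h1
  refine P.not_collinear ((collinear_pair ℝ (P.vertex ⟨0, hN⟩)
    (2 * P.center - P.vertex ⟨0, hN⟩)).subset ?_)
  rintro _ ⟨i, rfl⟩
  exact key i i.2

theorem exists_correspondsTo (hm : 0 < m) (hn : 0 < n) (hmn : Nat.Coprime m n) (ht : 0 < t) :
    ∃ x ∈ upperUnitRoots m n t, P.CorrespondsTo x := by
  obtain ⟨i, hi⟩ := P.exists_mem_longSides hm
  obtain ⟨j, hj⟩ := P.exists_notMem_longSides hn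
  set u := P.turn i with hu
  set v := P.turn j with hv
  have hU : ∀ k ∈ P.longSides, P.turn k = u := fun k hk => P.turn_eq_of_mem hk hi
  have hV : ∀ k ∉ P.longSides, P.turn k = v := fun k hk => P.turn_eq_of_notMem hk hj
  have hr := P.radius_pos
  have hnu : ‖u - 1‖ = t / P.radius := by rw [hu, norm_turn_sub_one, P.length_long i hi]
  have hnv : ‖v - 1‖ = 1 / P.radius := by rw [hv, norm_turn_sub_one, P.length_short j hj]
  have hu1 : ‖u‖ = 1 := P.norm_turn i
  have hv1 : ‖v‖ = 1 := P.norm_turn j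
  have hu0 : u ≠ 0 := norm_pos_iff.1 (by rw [hu1]; norm_num)
  have hv0 : v ≠ 0 := norm_pos_iff.1 (by rw [hv1]; norm_num)
  have hprod : u ^ m * v ^ n = 1 := by
    rw [← P.prod_turn, ← Finset.prod_mul_prod_compl P.longSides, Finset.prod_congr rfl hU,
      Finset.prod_congr rfl fun k hk => hV k (Finset.mem_compl.1 hk), Finset.prod_const,
      Finset.prod_const, P.card_long, P.card_compl_longSides]
  obtain ⟨a, b, hab⟩ : ∃ a b : ℤ, m * a + n * b = 1 := by
    refine ⟨m.gcdA n, m.gcdB n, ?_⟩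
    rw [← Nat.gcd_eq_gcd_ab, hmn.gcd_eq_one]; rfl
  have hum : u ^ (m : ℤ) = v ^ (-n : ℤ) := by
    rw [zpow_neg, zpow_natCast, zpow_natCast]; exact eq_inv_of_mul_eq_one_left hprod
  set x := v ^ a * u ^ (-b) with hx
  have hxm : x ^ m = v := by
    rw [← zpow_natCast, hx, mul_zpow, ← zpow_mul, ← zpow_mul, mul_comm (-b), zpow_mul u, hum,
      ← zpow_mul, ← zpow_add₀ hv0]
    rw [show a * (m : ℤ) + -n * -b = 1 by linear_combination hab, zpow_one]
  have hxn : x ^ n = u⁻¹ := by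
    rw [← zpow_natCast, hx, mul_zpow, ← zpow_mul, ← zpow_mul,
      show a * (n : ℤ) = (-n) * (-a) by ring, zpow_mul v, ← hum,
      ← zpow_mul, ← zpow_add₀ hu0]
    rw [show (m : ℤ) * -a + -b * n = -1 by linear_combination -hab, zpow_neg_one]
  have hx1 : ‖x‖ = 1 := by rw [hx, norm_mul, norm_zpow, norm_zpow, hu1, hv1]; simp
  have hx0 : x ≠ 0 := norm_pos_iff.1 (by rw [hx1]; norm_num)
  have hQ : ‖x ^ n - 1‖ / ‖x ^ m - 1‖ = t := by
    have : u⁻¹ - 1 = - (u⁻¹ * (u - 1)) := by field_simp; ring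
    rw [hxn, hxm, this, norm_neg, norm_mul, norm_inv, hu1, hnu, hnv]
    field_simp
  have him : x.im ≠ 0 := by
    intro him
    have hsq := Complex.sq_eq_one_of_norm_eq_one_of_im_eq_zero hx1 him
    have hv2 : v ^ 2 = 1 := by rw [← hxm, ← pow_mul, mul_comm, pow_mul, hsq, one_pow]
    have hu2 : u ^ 2 = 1 := by
      rw [← inv_inj, ← inv_pow, ← hxn, ← pow_mul, mul_comm, pow_mul, hsq, one_pow, inv_one]
    have hu' : u = -1 := by
      refine (mul_self_eq_one_iff.1 (sq u ▸ hu2)).resolve_left fun h => ?_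
      rw [h, sub_self, norm_zero] at hnu
      exact absurd hnu (by positivity)
    have hv' : v = -1 := by
      refine (mul_self_eq_one_iff.1 (sq v ▸ hv2)).resolve_left fun h => ?_
      rw [h, sub_self, norm_zero] at hnv
      exact absurd hnv (by positivity)
    obtain ⟨k, hk⟩ := P.exists_turn_ne_neg_one hm
    by_cases hkl : k ∈ P.longSides
    · exact hk (by rw [hU k hkl, hu'])
    · exact hk (by rw [hV k hkl, hv'])
  rcases him.lt_or_gt with him | him
  · have hinv : x⁻¹ = conj x := Complex.inv_eq_conj hx1
    refine ⟨x⁻¹, ⟨by simp [hx1], by rw [hinv, Complex.conj_im]; linarith, ?_⟩, Or.inr ⟨?_, ?_⟩⟩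
    · rw [ratQ_eq_zero_iff ht (by simp [hx1]), ← hQ, hinv, ← map_pow, ← map_pow, ← map_one conj,
        ← map_sub, ← map_sub, Complex.norm_conj, Complex.norm_conj]
      simp
    · intro k hk; rw [hV k hk, inv_pow, inv_inv, hxm]
    · intro k hk; rw [hU k hk, inv_pow, hxn, inv_inv]
  · refine ⟨x, ⟨hx1, him, (ratQ_eq_zero_iff ht hx1).2 hQ⟩, Or.inl ⟨?_, ?_⟩⟩
    · intro k hk; rw [hV k hk, hxm]
    · intro k hk; rw [hU k hk, hxn, inv_inv]

variable {P}

theorem CorrespondsTo.unique (hm : 0 < m) (hn : 0 < n) (hmn : Nat.Coprime m n) {y : ℂ}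
    (hx : x ∈ upperUnitRoots m n t) (hy : y ∈ upperUnitRoots m n t)
    (h : P.CorrespondsTo x) (h' : P.CorrespondsTo y) : x = y := by
  obtain ⟨i, hi⟩ := P.exists_mem_longSides hm
  obtain ⟨j, hj⟩ := P.exists_notMem_longSides hn
  have hy0 := upperUnitRoots.ne_zero hy
  have aux : x ≠ y⁻¹ := by
    intro h
    have h1 := hx.2.1
    have h2 := hy.2.1
    rw [h, Complex.inv_eq_conj hy.1, Complex.conj_im] at h1
    linarith
  rcases h with ⟨h1, h2⟩ | ⟨h1, h2⟩ <;> rcases h' with ⟨h3, h4⟩ | ⟨h3, h4⟩ <;>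
    have e1 := (h1 j hj).symm.trans (h3 j hj) <;> have e2 := (h2 i hi).symm.trans (h4 i hi)
  · exact eq_of_pow_eq_pow_of_coprime hmn hy0 e1 (inv_inj.1 e2)
  · exact (aux (eq_of_pow_eq_pow_of_coprime hmn (inv_ne_zero hy0) (by rw [e1, inv_pow])
      (by rw [← inv_inj, e2, inv_pow, inv_inv]))).elim
  · exact (aux (eq_of_pow_eq_pow_of_coprime hmn (inv_ne_zero hy0)
      (by rw [← inv_inj, e1, inv_pow, inv_inv]) (by rw [e2, inv_pow]))).elim
  · exact eq_of_pow_eq_pow_of_coprime hmn hy0 (inv_inj.1 e1) e2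

theorem CorrespondsTo.of_equivalent {P' : AdmissiblePolygon m n t} (hx : ‖x‖ = 1)
    (h : P.CorrespondsTo x) (hP : P.Equivalent P') : P'.CorrespondsTo x := by
  obtain ⟨-, e, he, hP⟩ := hP
  have key : ∀ i, ∃ k, i = e k := fun i => ⟨e.symm i, by simp⟩
  have hc : ∀ k : ℕ, conj (x ^ k) = (x ^ k)⁻¹ := fun k =>
    (Complex.inv_eq_conj (by rw [norm_pow, hx, one_pow])).symm
  rcases hP with hP | hP
  · rcases h with ⟨h1, h2⟩ | ⟨h1, h2⟩
    · refine Or.inl ⟨fun i hi => ?_, fun i hi => ?_⟩ <;> obtain ⟨k, rfl⟩ := key i <;>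
        rw [← he] at hi <;> simp_all
    · refine Or.inr ⟨fun i hi => ?_, fun i hi => ?_⟩ <;> obtain ⟨k, rfl⟩ := key i <;>
        rw [← he] at hi <;> simp_all
  · rcases h with ⟨h1, h2⟩ | ⟨h1, h2⟩
    · refine Or.inr ⟨fun i hi => ?_, fun i hi => ?_⟩ <;> obtain ⟨k, rfl⟩ := key i <;>
        rw [← he] at hi
      · rw [hP, h1 k hi, hc]
      · rw [hP, h2 k hi, map_inv₀, hc, inv_inv]
    · refine Or.inl ⟨fun i hi => ?_, fun i hi => ?_⟩ <;> obtain ⟨k, rfl⟩ := key i <;>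
        rw [← he] at hi
      · rw [hP, h1 k hi, map_inv₀, hc, inv_inv]
      · rw [hP, h2 k hi, hc]

theorem CorrespondsTo.radius_eq (hn : 0 < n) (hx : ‖x‖ = 1) (h : P.CorrespondsTo x) :
    P.radius = 1 / ‖x ^ m - 1‖ := by
  obtain ⟨j, hj⟩ := P.exists_notMem_longSides hn
  have h1 := P.norm_turn_sub_one j
  rw [P.length_short j hj] at h1
  have h2 : ‖P.turn j - 1‖ = ‖x ^ m - 1‖ := by
    rcases h with ⟨h, -⟩ | ⟨h, -⟩
    · rw [h j hj]
    · have hc : (x ^ m)⁻¹ = conj (x ^ m) := Complex.inv_eq_conj (by rw [norm_pow, hx, one_pow])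
      rw [h j hj, hc, ← map_one conj, ← map_sub, Complex.norm_conj, map_one]
  rw [← h2, h1, one_div_one_div]

theorem CorrespondsTo.equivalent {P' : AdmissiblePolygon m n t} (hn : 0 < n) (hx : ‖x‖ = 1)
    (h : P.CorrespondsTo x) (h' : P'.CorrespondsTo x) : P.Equivalent P' := by
  refine ⟨(h.radius_eq hn hx).trans (h'.radius_eq hn hx).symm, ?_⟩
  have e1 : {i // i ∈ P.longSides} ≃ {i // i ∈ P'.longSides} :=
    Fintype.equivOfCardEq (by simp [P.card_long, P'.card_long])
  have e2 : {i // i ∉ P.longSides} ≃ {i // i ∉ P'.longSides} :=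
    Fintype.equivOfCardEq (by
      rw [Fintype.card_subtype_compl, Fintype.card_subtype_compl]
      simp [P.card_long, P'.card_long])
  have he : ∀ i, i ∈ P.longSides ↔ e1.subtypeCongr e2 i ∈ P'.longSides := by
    intro i
    by_cases hi : i ∈ P.longSides
    · simp [Equiv.subtypeCongr, hi, Equiv.sumCompl_symm_apply_of_pos hi]
    · simp [Equiv.subtypeCongr, hi, Equiv.sumCompl_symm_apply_of_neg hi, (e2 ⟨i, hi⟩).2]
  refine ⟨e1.subtypeCongr e2, he, ?_⟩
  have hc : ∀ k : ℕ, conj (x ^ k) = (x ^ k)⁻¹ := fun k =>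
    (Complex.inv_eq_conj (by rw [norm_pow, hx, one_pow])).symm
  rcases h with ⟨h1, h2⟩ | ⟨h1, h2⟩ <;> rcases h' with ⟨h3, h4⟩ | ⟨h3, h4⟩
  · left; intro i
    by_cases hi : i ∈ P.longSides
    · rw [h2 i hi, h4 _ ((he i).1 hi)]
    · rw [h1 i hi, h3 _ (mt (he i).2 hi)]
  · right; intro i
    by_cases hi : i ∈ P.longSides
    · rw [h2 i hi, h4 _ ((he i).1 hi), map_inv₀, hc, inv_inv]
    · rw [h1 i hi, h3 _ (mt (he i).2 hi), hc]
  · right; intro i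
    by_cases hi : i ∈ P.longSides
    · rw [h2 i hi, h4 _ ((he i).1 hi), hc]
    · rw [h1 i hi, h3 _ (mt (he i).2 hi), map_inv₀, hc, inv_inv]
  · left; intro i
    by_cases hi : i ∈ P.longSides
    · rw [h2 i hi, h4 _ ((he i).1 hi)]
    · rw [h1 i hi, h3 _ (mt (he i).2 hi)]

end AdmissiblePolygon

/-- The vertices of the polygon inscribed in the unit circle, starting at `1`, with central angles
`m σ` for the first `n` sides and `- n σ` for the other ones, where `x = exp (i σ)`. -/
noncomputable def unitVertex (m n : ℕ) (x : ℂ) (k : ℕ) : ℂ := (x ^ m) ^ min k n * ((x ^ n)⁻¹) ^ (k - n)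

theorem unitVertex_succ (m n : ℕ) (x : ℂ) (k : ℕ) :
    unitVertex m n x (k + 1) = unitVertex m n x k * if k < n then x ^ m else (x ^ n)⁻¹ := by
  unfold unitVertex
  split_ifs with h
  · rw [min_eq_left h, min_eq_left h.le, Nat.sub_eq_zero_of_le h, Nat.sub_eq_zero_of_le h.le,
      pow_succ]; ring
  · rw [min_eq_right (by omega), min_eq_right (by omega), show k + 1 - n = k - n + 1 by omega,
      pow_succ]; ring

theorem unitVertex_add (m n : ℕ) {x : ℂ} (hx : x ≠ 0) :
    unitVertex m n x (m + n) = unitVertex m n x 0 := by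
  simp only [unitVertex, Nat.le_add_left, inf_of_le_right, Nat.add_sub_cancel, Nat.zero_le,
    inf_of_le_left, pow_zero, Nat.zero_sub, mul_one, inv_pow]
  rw [← pow_mul, ← pow_mul, mul_comm m n]
  exact mul_inv_cancel₀ (pow_ne_zero _ hx)

theorem norm_unitVertex (m n : ℕ) {x : ℂ} (hx : ‖x‖ = 1) (k : ℕ) :
    ‖unitVertex m n x k‖ = 1 := by
  simp [unitVertex, hx]

theorem unitVertex_finRotate (m n : ℕ) {x : ℂ} (hx : x ≠ 0) (i : Fin (m + n)) :
    unitVertex m n x (finRotate (m + n) i) = unitVertex m n x (i + 1) := by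
  have h0 := unitVertex_add m n hx
  generalize unitVertex m n x = f at *
  generalize m + n = N at *
  cases N with
  | zero => exact i.elim0
  | succ N =>
    rw [coe_finRotate]
    split_ifs with h
    · rw [h, ← h0]; simp
    · rfl

theorem sideTurn_unitVertex (m n : ℕ) {x : ℂ} (hx : ‖x‖ = 1) {R : ℝ} (hR : 0 < R)
    (i : Fin (m + n)) :
    sideTurn 0 (fun k : Fin (m + n) => (R : ℂ) * unitVertex m n x k) i =
      if (i : ℕ) < n then x ^ m else (x ^ n)⁻¹ := by
  have hx0 : x ≠ 0 := norm_pos_iff.1 (by rw [hx]; norm_num)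
  have h1 : unitVertex m n x i ≠ 0 := norm_pos_iff.1 (by rw [norm_unitVertex m n hx]; norm_num)
  have hR' : (R : ℂ) ≠ 0 := by exact_mod_cast hR.ne'
  rw [sideTurn, sub_zero, sub_zero, unitVertex_finRotate m n hx0, unitVertex_succ]
  field_simp

theorem norm_unitVertex_finRotate_sub (m n : ℕ) {x : ℂ} (hx : ‖x‖ = 1) (i : Fin (m + n)) :
    ‖unitVertex m n x (finRotate (m + n) i) - unitVertex m n x i‖ =
      ‖(if (i : ℕ) < n then x ^ m else (x ^ n)⁻¹) - 1‖ := by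
  have hx0 : x ≠ 0 := norm_pos_iff.1 (by rw [hx]; norm_num)
  rw [unitVertex_finRotate m n hx0, unitVertex_succ, ← mul_sub_one, norm_mul,
    norm_unitVertex m n hx, one_mul]

theorem not_collinear_unitVertex {m n : ℕ} (hm : 0 < m) (hn : 0 < n) (hmn : m.Coprime n)
    (h12 : 1 < m ∨ 1 < n)
    {x : ℂ} (hx : ‖x‖ = 1) (hx2 : x ^ 2 ≠ 1) (hm1 : x ^ m ≠ 1) (hn1 : x ^ n ≠ 1)
    {R : ℝ} (hR : 0 < R) :
    ¬ Collinear ℝ (Set.range fun k : Fin (m + n) => (R : ℂ) * unitVertex m n x k) := by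
  intro hcol
  have hx0 : x ≠ 0 := norm_pos_iff.1 (by rw [hx]; norm_num)
  have hR' : (R : ℂ) ≠ 0 := by exact_mod_cast hR.ne'
  have hne : ∀ k, unitVertex m n x k ≠ 0 := fun k =>
    norm_pos_iff.1 (by rw [norm_unitVertex m n hx]; norm_num)
  have hsucc : ∀ k, unitVertex m n x (k + 1) ≠ unitVertex m n x k := by
    intro k h
    rw [unitVertex_succ, mul_eq_left₀ (hne k)] at h
    split_ifs at h
    · exact hm1 h
    · exact hn1 (inv_eq_one.1 h)
  have hsph : EuclideanGeometry.Cospherical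
      (Set.range fun k : Fin (m + n) => (R : ℂ) * unitVertex m n x k) := by
    refine ⟨0, R, ?_⟩
    rintro _ ⟨k, rfl⟩
    simp [norm_unitVertex m n hx, abs_of_pos hR]
  have hback : ∀ k, k + 2 ≤ m + n → unitVertex m n x (k + 2) = unitVertex m n x k := by
    intro k hk
    by_contra hne2
    have hinj : ∀ a b, unitVertex m n x a ≠ unitVertex m n x b →
        (R : ℂ) * unitVertex m n x a ≠ R * unitVertex m n x b :=
      fun a b hab h => hab (mul_left_cancel₀ hR' h)
    have hmem : ∀ a, a ≤ m + n → (R : ℂ) * unitVertex m n x a ∈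
        Set.range fun k : Fin (m + n) => (R : ℂ) * unitVertex m n x k := by
      intro a ha
      rcases ha.lt_or_eq with ha | rfl
      · exact ⟨⟨a, ha⟩, rfl⟩
      · exact ⟨⟨0, by omega⟩, by rw [unitVertex_add m n hx0]⟩
    have hind := hsph.affineIndependent_of_mem_of_ne (hmem k (by omega))
      (hmem (k + 1) (by omega)) (hmem (k + 2) hk) (hinj _ _ (hsucc k).symm)
      (hinj _ _ (Ne.symm hne2)) (hinj _ _ (hsucc (k + 1)).symm)
    rw [affineIndependent_iff_not_collinear] at hind
    refine hind (hcol.subset ?_)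
    rintro _ ⟨j, rfl⟩
    fin_cases j
    · exact hmem k (by omega)
    · exact hmem (k + 1) (by omega)
    · exact hmem (k + 2) hk
  have hmul : ∀ k, k + 2 ≤ m + n → (if k < n then x ^ m else (x ^ n)⁻¹) *
      (if k + 1 < n then x ^ m else (x ^ n)⁻¹) = 1 := by
    intro k hk
    have h := hback k hk
    rwa [unitVertex_succ, unitVertex_succ, mul_assoc, mul_eq_left₀ (hne k)] at h
  have h0 := hmul (n - 1) (by omega)
  rw [if_pos (by omega), if_neg (by omega)] at h0
  have hxn0 : x ^ n ≠ 0 := pow_ne_zero _ hx0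
  have heq : x ^ m = x ^ n := by rwa [← div_eq_mul_inv, div_eq_one_iff_eq hxn0] at h0
  have h2 : (x ^ m) ^ 2 = 1 := by
    rcases h12 with h | h
    · have h1 := hmul n (by omega)
      rw [if_neg (by omega), if_neg (by omega), ← heq, ← sq, inv_pow] at h1
      exact inv_eq_one.1 h1
    · have h1 := hmul 0 (by omega)
      rwa [if_pos (by omega), if_pos (by omega), ← sq] at h1
  refine hx2 (eq_one_of_pow_eq_one_of_coprime hmn (by rw [pow_right_comm, h2]) ?_)
  rw [pow_right_comm, ← heq, h2]

theorem AdmissiblePolygon.exists_of_mem_upperUnitRoots (hm : 0 < m) (hn : 0 < n)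
    (hmn : Nat.Coprime m n) (ht : 0 < t) (hne : ¬ (m = 1 ∧ n = 1 ∧ t = 1))
    (hx : x ∈ upperUnitRoots m n t) : ∃ P : AdmissiblePolygon m n t, P.CorrespondsTo x := by
  have hx1 := hx.1
  have hvpos := upperUnitRoots.norm_pow_sub_one_pos ht hx
  have hQ := upperUnitRoots.norm_div_eq ht hx
  set R : ℝ := 1 / ‖x ^ m - 1‖ with hRdef
  have hR : 0 < R := by positivity
  have hm1 : x ^ m ≠ 1 := sub_ne_zero.1 (norm_pos_iff.1 hvpos)
  have hn1 : x ^ n ≠ 1 := by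
    intro h
    rw [h, sub_self, norm_zero, zero_div] at hQ
    exact ht.ne hQ
  have hcard : (Finset.univ.filter fun i : Fin (m + n) => ¬ (i : ℕ) < n).card = m := by
    have h1 := Fin.card_filter_val_lt (n := m + n) (m := n)
    have h2 := Finset.card_filter_add_card_filter_not (s := Finset.univ)
      fun i : Fin (m + n) => (i : ℕ) < n
    rw [h1, Finset.card_univ, Fintype.card_fin] at h2
    omega
  have hmem : ∀ i : Fin (m + n), i ∈ (Finset.univ.filter fun i : Fin (m + n) => ¬ (i : ℕ) < n) ↔
      ¬ (i : ℕ) < n := fun i => Finset.mem_filter_univ i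
  have hinv : ‖(x ^ n)⁻¹ - 1‖ = ‖x ^ n - 1‖ := by
    rw [Complex.inv_eq_conj (by rw [norm_pow, hx1, one_pow]), ← map_one conj, ← map_sub,
      Complex.norm_conj, map_one]
  have hlen : ∀ i : Fin (m + n), ‖(R : ℂ) * unitVertex m n x (finRotate (m + n) i) -
      R * unitVertex m n x i‖ = R * ‖(if (i : ℕ) < n then x ^ m else (x ^ n)⁻¹) - 1‖ := by
    intro i
    rw [← mul_sub, norm_mul, norm_unitVertex_finRotate_sub m n hx1, Complex.norm_real,
      Real.norm_of_nonneg hR.le]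
  refine ⟨{ center := 0, radius := R, vertex := fun k => R * unitVertex m n x k
            longSides := Finset.univ.filter fun i : Fin (m + n) => ¬ (i : ℕ) < n
            radius_pos := hR, card_long := hcard
            cyclic := fun i => ?_, length_long := ?_, length_short := ?_
            direction_long := ?_, direction_short := ?_
            not_collinear := not_collinear_unitVertex hm hn hmn
              (upperUnitRoots.one_lt_add hm hn ht hne hx) hx1 (upperUnitRoots.sq_ne_one hx)
              hm1 hn1 hR }, Or.inl ⟨?_, ?_⟩⟩
  · simp [norm_unitVertex m n hx1, abs_of_pos hR]
  · intro i hi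
    rw [hmem] at hi
    rw [hlen, if_neg hi, hinv, hRdef, one_div_mul_eq_div, hQ]
  · intro i hi
    rw [hmem, not_not] at hi
    rw [hlen, if_pos hi, hRdef, one_div_mul_cancel hvpos.ne']
  · refine (le_total 0 ((x ^ n)⁻¹).im).imp (fun h i hi => ?_) (fun h i hi => ?_) <;>
      rwa [sideTurn_unitVertex m n hx1 hR, if_neg ((hmem i).1 hi)]
  · refine (le_total 0 (x ^ m).im).imp (fun h i hi => ?_) (fun h i hi => ?_) <;>
      rwa [sideTurn_unitVertex m n hx1 hR,
        if_pos (not_not.1 (mt (hmem i).2 hi))]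
  · intro i hi
    exact (sideTurn_unitVertex m n hx1 hR i).trans
      (if_pos (not_not.1 (mt (hmem i).2 hi)))
  · intro i hi
    exact (sideTurn_unitVertex m n hx1 hR i).trans (if_neg ((hmem i).1 hi))

theorem AdmissiblePolygon.finite_quotient (hm : 0 < m) (hn : 0 < n)
    (hmn : Nat.Coprime m n) (ht : 0 < t) (hne : ¬ (m = 1 ∧ n = 1 ∧ t = 1)) :
    Finite (Quotient (AdmissiblePolygon.setoid m n t)) := by
  have := (finite_upperUnitRoots hm hn hmn ht hne).to_subtype
  choose f hf using fun x : upperUnitRoots m n t =>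
    AdmissiblePolygon.exists_of_mem_upperUnitRoots hm hn hmn ht hne x.2
  refine Finite.of_surjective
    (fun x => (Quotient.mk (AdmissiblePolygon.setoid m n t) (f x))) fun q => ?_
  induction q using Quotient.inductionOn with | _ P
  obtain ⟨x, hx, hP⟩ := P.exists_correspondsTo hm hn hmn ht
  exact ⟨⟨x, hx⟩, Quotient.sound ((hf ⟨x, hx⟩).equivalent hn hx.1 hP)⟩

end

section

open Real MeasureTheory Filter Topology intervalIntegral

theorem norm_one_sub_mul_exp_sq (r φ : ℝ) :
    ‖1 - (r : ℂ) * Complex.exp ((2 * φ : ℝ) * Complex.I)‖ ^ 2 =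
      (1 - r) ^ 2 + 4 * r * sin φ ^ 2 := by
  rw [Complex.sq_norm, Complex.normSq_apply]
  simp only [Complex.sub_re, Complex.one_re, Complex.mul_re, Complex.ofReal_re, Complex.ofReal_im,
    Complex.exp_ofReal_mul_I_re, Complex.exp_ofReal_mul_I_im, Complex.sub_im, Complex.one_im,
    Complex.mul_im, Real.cos_two_mul, Real.sin_two_mul]
  linear_combination (4 * r ^ 2 * cos φ ^ 2 - 4 * r) * sin_sq_add_cos_sq φ

theorem hasSum_log_norm_one_sub {r : ℝ} (h0 : 0 ≤ r) (h1 : r < 1) (φ : ℝ) :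
    HasSum (fun k : ℕ => r ^ k * cos (2 * k * φ) / k)
      (- log ‖1 - (r : ℂ) * Complex.exp ((2 * φ : ℝ) * Complex.I)‖) := by
  have hz : ‖(r : ℂ) * Complex.exp ((2 * φ : ℝ) * Complex.I)‖ < 1 := by
    rw [norm_mul, Complex.norm_exp_ofReal_mul_I, Complex.norm_real, norm_of_nonneg h0, mul_one]
    exact h1
  have h := Complex.hasSum_re (Complex.hasSum_taylorSeries_neg_log hz)
  rw [Complex.neg_re, Complex.log_re] at h
  convert h using 2 with k
  rw [mul_pow, ← Complex.exp_nat_mul, show (k : ℂ) * ((2 * φ : ℝ) * Complex.I) =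
    ((2 * k * φ : ℝ) : ℂ) * Complex.I by push_cast; ring, ← Complex.ofReal_pow,
    show (k : ℂ) = ((k : ℝ) : ℂ) by simp, Complex.div_ofReal_re, Complex.re_ofReal_mul,
    Complex.exp_ofReal_mul_I_re]

theorem integral_pow_mul_cos_div (r γ : ℝ) (k : ℕ) :
    ∫ φ in (0 : ℝ)..γ, r ^ k * cos (2 * k * φ) / k = r ^ k * sin (2 * k * γ) / (2 * k ^ 2) := by
  rcases eq_or_ne k 0 with rfl | hk
  · simp
  have hk' : (2 * k : ℝ) ≠ 0 := by positivity
  simp_rw [mul_div_right_comm]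
  rw [intervalIntegral.integral_const_mul, intervalIntegral.integral_comp_mul_left cos hk',
    integral_cos]
  simp only [mul_zero, sin_zero, sub_zero, smul_eq_mul]
  field_simp

theorem hasSum_sin_div_sq_of_lt_one {r : ℝ} (h0 : 0 ≤ r) (h1 : r < 1) (γ : ℝ) :
    HasSum (fun k : ℕ => r ^ k * sin (2 * k * γ) / (2 * k ^ 2))
      (- ∫ φ in (0 : ℝ)..γ, log ‖1 - (r : ℂ) * Complex.exp ((2 * φ : ℝ) * Complex.I)‖) := by
  rw [← intervalIntegral.integral_neg]
  simp_rw [← integral_pow_mul_cos_div]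
  refine intervalIntegral.hasSum_integral_of_dominated_convergence (fun k _ => r ^ k) ?_ ?_ ?_ ?_ ?_
  · exact fun k => Continuous.aestronglyMeasurable (by fun_prop)
  · refine fun k => ae_of_all _ fun φ _ => ?_
    rw [norm_div, norm_mul, norm_of_nonneg (pow_nonneg h0 k), norm_natCast]
    rcases Nat.eq_zero_or_pos k with rfl | hk
    · simp
    · have h2 : ‖cos (2 * k * φ)‖ ≤ 1 := abs_cos_le_one _
      have h3 : (1 : ℝ) ≤ k := by exact_mod_cast hk
      rw [div_le_iff₀ (by positivity)]
      exact mul_le_mul_of_nonneg_left (h2.trans h3) (pow_nonneg h0 k)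
  · exact ae_of_all _ fun φ _ => summable_geometric_of_lt_one h0 h1
  · exact intervalIntegrable_const
  · exact ae_of_all _ fun φ _ => hasSum_log_norm_one_sub h0 h1 φ

theorem tendsto_integral_log_norm_one_sub {γ : ℝ} (h0 : 0 ≤ γ) (h1 : γ ≤ π / 2) :
    Tendsto (fun r : ℝ => ∫ φ in (0 : ℝ)..γ,
      log ‖1 - (r : ℂ) * Complex.exp ((2 * φ : ℝ) * Complex.I)‖) (𝓝[<] 1)
      (𝓝 (∫ φ in (0 : ℝ)..γ, log (2 * sin φ))) := by
  refine intervalIntegral.tendsto_integral_filter_of_dominated_convergence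
    (fun φ => |log (sin φ)| + log 2) ?_ ?_ ?_ ?_
  · exact Eventually.of_forall fun r => Measurable.aestronglyMeasurable (by fun_prop)
  · filter_upwards [Ioo_mem_nhdsLT (show (1 / 4 : ℝ) < 1 by norm_num)] with r hr
    refine ae_of_all _ fun φ hφ => ?_
    rw [Set.uIoc_of_le h0] at hφ
    have hs : 0 < sin φ := sin_pos_of_pos_of_lt_pi hφ.1 (by linarith [hφ.2, pi_pos])
    have hsq := norm_one_sub_mul_exp_sq r φ
    set y := ‖1 - (r : ℂ) * Complex.exp ((2 * φ : ℝ) * Complex.I)‖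
    have hy0 : 0 ≤ y := norm_nonneg _
    have hy1 : sin φ ≤ y := by
      refine (sq_le_sq₀ hs.le hy0).1 ?_
      rw [hsq]
      nlinarith [sq_nonneg (1 - r), hr.1, sq_pos_of_pos hs]
    have hy2 : y ≤ 2 := by
      refine (sq_le_sq₀ hy0 zero_le_two).1 ?_
      rw [hsq]
      nlinarith [sin_sq_le_one φ, hr.1, hr.2]
    have hl1 := log_le_log hs hy1
    have hl2 := log_le_log (hs.trans_le hy1) hy2
    have hl3 : 0 ≤ log 2 := log_nonneg one_le_two
    rw [norm_eq_abs, abs_le]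
    exact ⟨by linarith [neg_abs_le (log (sin φ))], by linarith [abs_nonneg (log (sin φ))]⟩
  · exact (intervalIntegrable_log_sin.abs).add intervalIntegrable_const
  · refine ae_of_all _ fun φ hφ => ?_
    rw [Set.uIoc_of_le h0] at hφ
    have hs : 0 < sin φ := sin_pos_of_pos_of_lt_pi hφ.1 (by linarith [hφ.2, pi_pos])
    have h2 : ‖1 - ((1 : ℝ) : ℂ) * Complex.exp ((2 * φ : ℝ) * Complex.I)‖ = 2 * sin φ := by
      refine (sq_eq_sq₀ (norm_nonneg _) (by positivity)).1 ?_
      rw [norm_one_sub_mul_exp_sq]; ring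
    rw [← h2]
    refine Tendsto.log (tendsto_nhdsWithin_of_tendsto_nhds ?_) (by rw [h2]; positivity)
    exact Continuous.tendsto (by fun_prop) (1 : ℝ)

theorem tsum_sin_div_sq {γ : ℝ} (h0 : 0 ≤ γ) (h1 : γ ≤ π / 2) :
    ∑' k : ℕ, sin (2 * k * γ) / (2 * k ^ 2) = - ∫ φ in (0 : ℝ)..γ, log (2 * sin φ) := by
  refine tendsto_nhds_unique ?_ (tendsto_integral_log_norm_one_sub h0 h1).neg
  have hL : Tendsto (fun r : ℝ => ∑' k : ℕ, r ^ k * sin (2 * k * γ) / (2 * k ^ 2)) (𝓝[<] 1)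
      (𝓝 (∑' k : ℕ, sin (2 * k * γ) / (2 * k ^ 2))) := by
    refine tendsto_tsum_of_dominated_convergence (bound := fun k : ℕ => 1 / (k : ℝ) ^ 2)
      (summable_one_div_nat_pow.2 one_lt_two) (fun k => ?_) ?_
    · refine tendsto_nhdsWithin_of_tendsto_nhds ?_
      have : Continuous fun r : ℝ => r ^ k * sin (2 * k * γ) / (2 * k ^ 2) := by fun_prop
      simpa using this.tendsto 1
    · filter_upwards [Ioo_mem_nhdsLT (show (0 : ℝ) < 1 by norm_num)] with r hr k
      rcases Nat.eq_zero_or_pos k with rfl | hk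
      · simp
      have hk' : (0 : ℝ) < k := by exact_mod_cast hk
      rw [norm_div, norm_mul, norm_of_nonneg (pow_nonneg hr.1.le k),
        norm_of_nonneg (by positivity : (0 : ℝ) ≤ 2 * k ^ 2)]
      have h2 : ‖sin (2 * k * γ)‖ ≤ 1 := abs_sin_le_one _
      have h3 : r ^ k ≤ 1 := pow_le_one₀ hr.1.le hr.2.le
      refine div_le_div₀ zero_le_one (mul_le_one₀ h3 (norm_nonneg _) h2) (by positivity) ?_
      nlinarith [sq_pos_of_pos hk']
  refine hL.congr' ?_
  filter_upwards [Ioo_mem_nhdsLT (show (0 : ℝ) < 1 by norm_num)] with r hr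
  exact (hasSum_sin_div_sq_of_lt_one hr.1.le hr.2 γ).tsum_eq

theorem summable_dilogSeries {z : ℂ} (hz : ‖z‖ ≤ 1) :
    Summable fun k : ℕ => z ^ (k + 1) / ((k : ℂ) + 1) ^ 2 := by
  have h := (summable_nat_add_iff 1).2 (Real.summable_one_div_nat_pow.2 one_lt_two)
  refine Summable.of_norm_bounded h fun k => ?_
  rw [norm_div, norm_pow, norm_pow]
  have : ‖(k : ℂ) + 1‖ = ((k + 1 : ℕ) : ℝ) := by
    rw [← Complex.norm_natCast]; push_cast; rfl
  rw [this]
  gcongr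
  exact pow_le_one₀ (norm_nonneg _) hz

theorem blochWigner_of_norm_eq_one {z : ℂ} (hz : ‖z‖ = 1) :
    blochWigner z = (dilogSeries z).im := by
  rw [blochWigner, if_pos hz.le, blochWignerDisc, hz]; simp

open ComplexConjugate in
theorem blochWigner_conj {z : ℂ} (hz : ‖z‖ = 1) : blochWigner (conj z) = - blochWigner z := by
  rw [blochWigner_of_norm_eq_one hz, blochWigner_of_norm_eq_one (by rwa [Complex.norm_conj]),
    ← Complex.conj_im, dilogSeries, dilogSeries, Complex.conj_tsum]
  simp

theorem blochWigner_exp {γ : ℝ} (h0 : 0 ≤ γ) (h1 : γ ≤ π / 2) :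
    blochWigner (Complex.exp ((2 * γ : ℝ) * Complex.I)) =
      - 2 * ∫ φ in (0 : ℝ)..γ, log (2 * sin φ) := by
  have hz := Complex.norm_exp_ofReal_mul_I (2 * γ)
  rw [blochWigner_of_norm_eq_one hz, dilogSeries, Complex.im_tsum (summable_dilogSeries hz.le)]
  have key : ∀ k : ℕ, (Complex.exp ((2 * γ : ℝ) * Complex.I) ^ (k + 1) / ((k : ℂ) + 1) ^ 2).im =
      2 * (sin (2 * (k + 1 : ℕ) * γ) / (2 * ((k + 1 : ℕ) : ℝ) ^ 2)) := by
    intro k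
    rw [← Complex.exp_nat_mul, show ((k + 1 : ℕ) : ℂ) * ((2 * γ : ℝ) * Complex.I) =
      ((2 * (k + 1 : ℕ) * γ : ℝ) : ℂ) * Complex.I by push_cast; ring,
      show ((k : ℂ) + 1) ^ 2 = (((k + 1 : ℕ) : ℝ) ^ 2 : ℝ) by push_cast; rfl,
      Complex.div_ofReal_im, Complex.exp_ofReal_mul_I_im]
    field_simp
  have hsum := (Complex.hasSum_im (summable_dilogSeries hz.le).hasSum).summable
  simp_rw [key] at hsum ⊢
  have hs := tsum_sin_div_sq h0 h1
  have hsum' : Summable fun k : ℕ => sin (2 * (k + 1 : ℕ) * γ) / (2 * ((k + 1 : ℕ) : ℝ) ^ 2) :=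
    (summable_mul_left_iff two_ne_zero).1 hsum
  rw [tsum_eq_zero_add' (f := fun k : ℕ => sin (2 * k * γ) / (2 * (k : ℝ) ^ 2)) hsum'] at hs
  rw [tsum_mul_left]
  simp only [CharP.cast_eq_zero, mul_zero, zero_mul, sin_zero, zero_div, zero_add] at hs
  rw [hs]; ring

end

section

open Real MeasureTheory Filter Topology intervalIntegral Set

theorem lintegral_one_div_pow_three {a : ℝ} (ha : 0 < a) :
    ∫⁻ h in {h : ℝ | a ≤ h ^ 2 ∧ 0 < h}, ENNReal.ofReal (1 / h ^ 3) =
      ENNReal.ofReal (1 / (2 * a)) := by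
  have hs : {h : ℝ | a ≤ h ^ 2 ∧ 0 < h} = Ici (√a) := by
    ext h
    simp only [mem_ofPred_eq, mem_Ici]
    constructor
    · rintro ⟨h1, h2⟩; exact (sqrt_le_left h2.le).2 h1
    · intro h1
      have h2 : 0 < h := (sqrt_pos.2 ha).trans_le h1
      exact ⟨(sqrt_le_left h2.le).1 h1, h2⟩
  rw [hs, setLIntegral_congr Ioi_ae_eq_Ici.symm]
  have hpos := sqrt_pos.2 ha
  have hrw : EqOn (fun h : ℝ => 1 / h ^ 3) (fun h => h ^ (-3 : ℝ)) (Ioi (√a)) := fun h hh => by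
    have : 0 < h := hpos.trans hh
    simp only
    rw [rpow_neg this.le, one_div]
    norm_cast
  have hii : IntegrableOn (fun h : ℝ => 1 / h ^ 3) (Ioi (√a)) :=
    (integrableOn_congr_fun hrw measurableSet_Ioi).2
      (integrableOn_Ioi_rpow_of_lt (by norm_num) hpos)
  rw [← ofReal_integral_eq_lintegral_ofReal hii
    ((ae_restrict_iff' measurableSet_Ioi).2 (ae_of_all _ fun h hh => by
      have : 0 < h := hpos.trans hh
      simp only [Pi.zero_apply]; positivity)),
    setIntegral_congr_fun measurableSet_Ioi hrw, integral_Ioi_rpow_of_lt (by norm_num) hpos]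
  congr 1
  rw [show (-3 + 1 : ℝ) = -(2 : ℕ) by norm_num, rpow_neg hpos.le, rpow_natCast, sq_sqrt ha.le]
  field_simp
  norm_num

theorem hyperbolicVolume_above_hemisphere {T : Set ℂ} (hT : MeasurableSet T) {c : ℂ} {R : ℝ}
    (hsub : T ⊆ Metric.closedBall c R) (hR : R ≠ 0) :
    hyperbolicVolume {p | p.1 ∈ T ∧ R ^ 2 ≤ ‖p.1 - c‖ ^ 2 + p.2 ^ 2 ∧ 0 < p.2} =
      (∫⁻ z in T, ENNReal.ofReal (1 / (2 * (R ^ 2 - ‖z - c‖ ^ 2)))).toReal := by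
  have hA : MeasurableSet
      ({p | p.1 ∈ T ∧ R ^ 2 ≤ ‖p.1 - c‖ ^ 2 + p.2 ^ 2 ∧ 0 < p.2} : Set (ℂ × ℝ)) := by
    have h1 : MeasurableSet {p : ℂ × ℝ | R ^ 2 ≤ ‖p.1 - c‖ ^ 2 + p.2 ^ 2} :=
      measurableSet_le (by fun_prop) (by fun_prop)
    have h2 : MeasurableSet {p : ℂ × ℝ | 0 < p.2} := measurableSet_lt (by fun_prop) (by fun_prop)
    convert (measurable_fst hT).inter (h1.inter h2) using 1
    ext; simp
  rw [hyperbolicVolume, inter_eq_self_of_subset_left (fun p hp => hp.2.2),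
    ← lintegral_indicator hA, Measure.volume_eq_prod,
    lintegral_prod _ ((Measurable.indicator (by fun_prop) hA).aemeasurable),
    ← lintegral_indicator hT]
  congr 1
  have hsph : ∀ᵐ z : ℂ, z ∉ Metric.sphere c R :=
    measure_eq_zero_iff_ae_notMem.1 (Measure.addHaar_sphere_of_ne_zero _ c hR)
  refine lintegral_congr_ae ?_
  filter_upwards [hsph] with z hz
  by_cases hzT : z ∈ T
  · have h1 := hsub hzT
    rw [mem_closedBall_iff_norm] at h1
    rw [mem_sphere_iff_norm] at hz
    have h2 : ‖z - c‖ < R := lt_of_le_of_ne h1 hz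
    have h3 : 0 < R ^ 2 - ‖z - c‖ ^ 2 := by nlinarith [norm_nonneg (z - c)]
    have hS : MeasurableSet {h : ℝ | R ^ 2 - ‖z - c‖ ^ 2 ≤ h ^ 2 ∧ 0 < h} := by
      have h4 : MeasurableSet {h : ℝ | R ^ 2 - ‖z - c‖ ^ 2 ≤ h ^ 2} :=
        measurableSet_le (by fun_prop) (by fun_prop)
      convert h4.inter (measurableSet_Ioi (a := (0 : ℝ))) using 1
      ext; simp
    rw [indicator_of_mem hzT, ← lintegral_one_div_pow_three h3, ← lintegral_indicator hS]
    congr 1 with h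
    simp only [indicator, mem_ofPred_eq, hzT, true_and, sub_le_iff_le_add, add_comm (h ^ 2)]
  · rw [indicator_of_notMem hzT]
    simp [indicator, hzT]

theorem mem_convexHull_triple {E : Type*} [AddCommGroup E] [Module ℝ E] {c p q z : E} :
    z ∈ convexHull ℝ {c, p, q} ↔
      ∃ a b : ℝ, 0 ≤ a ∧ 0 ≤ b ∧ a + b ≤ 1 ∧ z = c + (a • (p - c) + b • (q - c)) := by
  rw [convexHull_insert (by simp), convexHull_pair, mem_convexJoin]
  simp only [mem_singleton_iff, exists_eq_left, segment_eq_image', mem_image,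
    exists_exists_and_eq_and, mem_Icc]
  constructor
  · rintro ⟨s, hs, r, hr, rfl⟩
    refine ⟨r * (1 - s), r * s, mul_nonneg hr.1 (by linarith), mul_nonneg hr.1 hs.1,
      by linarith, ?_⟩
    module
  · rintro ⟨a, b, ha, hb, hab, rfl⟩
    rcases (add_nonneg ha hb).eq_or_lt with h | h
    · have ha' : a = 0 := by linarith
      have hb' : b = 0 := by linarith
      exact ⟨0, by simp, 0, by simp, by simp [ha', hb']⟩
    · refine ⟨b / (a + b), ⟨by positivity, (div_le_one h).2 (by linarith)⟩, a + b,
        ⟨h.le, hab⟩, ?_⟩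
      have e : (a + b) * (b / (a + b)) = b := by field_simp
      have : (a + b) • (p + (b / (a + b)) • (q - p) - c) =
        (a + b) • (p - c) + ((a + b) * (b / (a + b))) • (q - p) := by module
      rw [this, e]
      module

theorem lintegral_Ioc_div_sub_sq {R b : ℝ} (hb0 : 0 ≤ b) (hb : b < R) :
    ∫⁻ ρ in Ioc 0 b, ENNReal.ofReal (ρ / (2 * (R ^ 2 - ρ ^ 2))) =
      ENNReal.ofReal (- (1 / 4) * log (1 - b ^ 2 / R ^ 2)) := by
  have hR : 0 < R := hb0.trans_lt hb
  have hpos : ∀ ρ ∈ uIcc 0 b, 0 < R ^ 2 - ρ ^ 2 := fun ρ hρ => by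
    rw [uIcc_of_le hb0] at hρ
    nlinarith [hρ.1, hρ.2]
  have hderiv : ∀ ρ ∈ uIcc 0 b, HasDerivAt (fun ρ => - (1 / 4) * log (R ^ 2 - ρ ^ 2))
      (ρ / (2 * (R ^ 2 - ρ ^ 2))) ρ := fun ρ hρ => by
    have h1 := (((hasDerivAt_pow 2 ρ).const_sub (R ^ 2)).log (hpos ρ hρ).ne').const_mul (-(1 / 4))
    refine h1.congr_deriv (Eq.symm ?_)
    rw [div_eq_iff (by have := hpos ρ hρ; positivity)]
    have := (hpos ρ hρ).ne'
    field_simp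
    norm_num
    ring
  have hcont : ContinuousOn (fun ρ : ℝ => ρ / (2 * (R ^ 2 - ρ ^ 2))) (uIcc 0 b) :=
    ContinuousOn.div (by fun_prop) (by fun_prop) fun ρ hρ =>
      (mul_pos two_pos (hpos ρ hρ)).ne'
  have hii : IntervalIntegrable (fun ρ : ℝ => ρ / (2 * (R ^ 2 - ρ ^ 2))) volume 0 b :=
    hcont.intervalIntegrable
  rw [← ofReal_integral_eq_lintegral_ofReal
    ((intervalIntegrable_iff_integrableOn_Ioc_of_le hb0).1 hii)
    ((ae_restrict_iff' measurableSet_Ioc).2 (ae_of_all _ fun ρ hρ => by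
      have := hpos ρ (by rw [uIcc_of_le hb0]; exact ⟨hρ.1.le, hρ.2⟩)
      exact div_nonneg hρ.1.le (by positivity))),
    ← intervalIntegral.integral_of_le hb0, integral_eq_sub_of_hasDerivAt hderiv hii]
  congr 1
  have h2 := hpos b (by simp)
  rw [show 1 - b ^ 2 / R ^ 2 = (R ^ 2 - b ^ 2) / (R ^ 2 - 0 ^ 2) by field_simp; ring,
    log_div h2.ne' (by simp [hR.ne'])]
  ring

theorem intervalIntegrable_log_cos_apply {a b : ℝ} :
    IntervalIntegrable (fun φ => log (cos φ)) volume a b := intervalIntegrable_log_cos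

theorem integral_log_sin_two_mul {γ : ℝ} (h0 : 0 ≤ γ) (h1 : γ < π / 2) :
    ∫ s in (0 : ℝ)..(2 * γ), log (sin s) = 2 * ((∫ φ in (0 : ℝ)..γ, log (2 * sin φ)) +
      ∫ φ in (0 : ℝ)..γ, log (cos φ)) := by
  have e := intervalIntegral.integral_comp_mul_left (a := 0) (b := γ) (fun s => log (sin s))
    (two_ne_zero (α := ℝ))
  rw [mul_zero, smul_eq_mul] at e
  have hpos : ∀ φ ∈ uIoc 0 γ, 0 < sin φ ∧ 0 < cos φ := fun φ hφ => by
    rw [uIoc_of_le h0] at hφ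
    exact ⟨sin_pos_of_pos_of_lt_pi hφ.1 (by linarith [hφ.2, pi_pos]),
      cos_pos_of_mem_Ioo ⟨by linarith [hφ.1, pi_pos], by linarith [hφ.2]⟩⟩
  have hi1 : IntervalIntegrable (fun φ => log (2 * sin φ)) volume 0 γ := by
    refine IntervalIntegrable.congr (f := fun φ => log 2 + log (sin φ)) ?_
      (intervalIntegrable_const.add intervalIntegrable_log_sin)
    intro φ hφ
    simp only
    rw [log_mul two_ne_zero (hpos φ hφ).1.ne']
  rw [← intervalIntegral.integral_add hi1 intervalIntegrable_log_cos_apply]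
  have e2 : ∫ φ in (0 : ℝ)..γ, log (sin (2 * φ)) =
      ∫ φ in (0 : ℝ)..γ, (log (2 * sin φ) + log (cos φ)) := by
    refine intervalIntegral.integral_congr_ae (ae_of_all _ fun φ hφ => ?_)
    obtain ⟨hs, hc⟩ := hpos φ hφ
    rw [sin_two_mul, log_mul (by positivity) hc.ne']
  rw [← e2, e]
  ring

theorem intervalIntegrable_log_sin_sub (γ : ℝ) :
    IntervalIntegrable (fun φ => log (sin (γ - φ))) volume (-γ) γ := by
  have := (intervalIntegrable_log_sin (a := 2 * γ) (b := 0)).comp_sub_left γ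
  convert this using 1 <;> first | rfl | ring

theorem intervalIntegrable_log_sin_add (γ : ℝ) :
    IntervalIntegrable (fun φ => log (sin (γ + φ))) volume (-γ) γ := by
  have := (intervalIntegrable_log_sin (a := 0) (b := 2 * γ)).comp_add_left γ
  convert this using 1 <;> first | rfl | ring

theorem integral_log_sin_sub_add {γ : ℝ} (h0 : 0 ≤ γ) (h1 : γ < π / 2) :
    ∫ φ in (-γ)..γ, -(1 / 4) * (log (sin (γ - φ)) + log (sin (γ + φ)) - 2 * log (cos φ)) =
      - ∫ φ in (0 : ℝ)..γ, log (2 * sin φ) := by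
  rw [intervalIntegral.integral_const_mul, intervalIntegral.integral_sub
    ((intervalIntegrable_log_sin_sub γ).add (intervalIntegrable_log_sin_add γ))
    (intervalIntegrable_log_cos_apply.const_mul 2),
    intervalIntegral.integral_add (intervalIntegrable_log_sin_sub γ)
      (intervalIntegrable_log_sin_add γ), intervalIntegral.integral_const_mul,
    intervalIntegral.integral_comp_sub_left (fun s => log (sin s)),
    intervalIntegral.integral_comp_add_left (fun s => log (sin s)), sub_self, add_neg_cancel,
    sub_neg_eq_add, ← two_mul, ← two_mul, integral_log_sin_two_mul h0 h1]
  have hcos : ∫ φ in (-γ)..γ, log (cos φ) = 2 * ∫ φ in (0 : ℝ)..γ, log (cos φ) := by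
    rw [← intervalIntegral.integral_add_adjacent_intervals (b := 0)
      intervalIntegrable_log_cos_apply intervalIntegrable_log_cos_apply]
    have := intervalIntegral.integral_comp_neg (a := -γ) (b := 0) (fun φ => log (cos φ))
    simp only [cos_neg, neg_neg, neg_zero] at this
    rw [this]; ring
  rw [hcos]
  ring

end

section

open Real MeasureTheory Filter Topology intervalIntegral Set

/-- The triangle with vertices `0` and `R * exp (± i γ)`, described by its three sides. -/
def isoscelesTriangle (R γ : ℝ) : Set ℂ :=
  {y | y.re ≤ R * cos γ ∧ 0 ≤ y.re * sin γ - y.im * cos γ ∧ 0 ≤ y.re * sin γ + y.im * cos γ}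

theorem mem_isoscelesTriangle {R γ : ℝ} {y : ℂ} : y ∈ isoscelesTriangle R γ ↔
    y.re ≤ R * cos γ ∧ 0 ≤ y.re * sin γ - y.im * cos γ ∧ 0 ≤ y.re * sin γ + y.im * cos γ := Iff.rfl

theorem measurableSet_isoscelesTriangle (R γ : ℝ) : MeasurableSet (isoscelesTriangle R γ) := by
  have h1 : MeasurableSet {y : ℂ | y.re ≤ R * cos γ} :=
    measurableSet_le (by fun_prop) (by fun_prop)
  have h2 : MeasurableSet {y : ℂ | 0 ≤ y.re * sin γ - y.im * cos γ} :=
    measurableSet_le (by fun_prop) (by fun_prop)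
  have h3 : MeasurableSet {y : ℂ | 0 ≤ y.re * sin γ + y.im * cos γ} :=
    measurableSet_le (by fun_prop) (by fun_prop)
  convert h1.inter (h2.inter h3) using 1
  ext; simp [isoscelesTriangle]

theorem polar_mem_isoscelesTriangle_iff {R γ ρ φ : ℝ} (h0 : 0 < γ) (h1 : γ < π / 2)
    (hρ : 0 < ρ) (hφ : φ ∈ Ioo (-π) π) :
    (ρ : ℂ) * (cos φ + sin φ * Complex.I) ∈ isoscelesTriangle R γ ↔
      φ ∈ Icc (-γ) γ ∧ ρ ≤ R * cos γ / cos φ := by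
  have hre : ((ρ : ℂ) * (cos φ + sin φ * Complex.I)).re = ρ * cos φ := by
    simp [-Complex.ofReal_cos, -Complex.ofReal_sin]
  have him : ((ρ : ℂ) * (cos φ + sin φ * Complex.I)).im = ρ * sin φ := by
    simp [-Complex.ofReal_cos, -Complex.ofReal_sin]
  have e1 : ρ * cos φ * sin γ - ρ * sin φ * cos γ = ρ * sin (γ - φ) := by rw [sin_sub]; ring
  have e2 : ρ * cos φ * sin γ + ρ * sin φ * cos γ = ρ * sin (γ + φ) := by rw [sin_add]; ring
  rw [mem_isoscelesTriangle, hre, him, e1, e2, mul_nonneg_iff_of_pos_left hρ,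
    mul_nonneg_iff_of_pos_left hρ]
  have hiff : (0 ≤ sin (γ - φ) ∧ 0 ≤ sin (γ + φ)) ↔ φ ∈ Icc (-γ) γ := by
    constructor
    · rintro ⟨hs1, hs2⟩
      constructor
      · by_contra! h
        exact hs2.not_gt (sin_neg_of_neg_of_neg_pi_lt (by linarith) (by linarith [hφ.1]))
      · by_contra! h
        exact hs1.not_gt (sin_neg_of_neg_of_neg_pi_lt (by linarith) (by linarith [hφ.2]))
    · rintro ⟨h2, h3⟩
      exact ⟨sin_nonneg_of_nonneg_of_le_pi (by linarith) (by linarith),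
        sin_nonneg_of_nonneg_of_le_pi (by linarith) (by linarith)⟩
  rw [hiff, and_comm]
  refine and_congr_right fun h => ?_
  rw [le_div_iff₀ (cos_pos_of_mem_Ioo ⟨by linarith [h.1], by linarith [h.2]⟩)]

theorem lintegral_isoscelesTriangle_eq_polar {R γ : ℝ} (h0 : 0 < γ) (h1 : γ < π / 2) :
    ∫⁻ y in isoscelesTriangle R γ, ENNReal.ofReal (1 / (2 * (R ^ 2 - ‖y‖ ^ 2))) =
      ∫⁻ φ in Icc (-γ) γ, ∫⁻ ρ in Ioc 0 (R * cos γ / cos φ),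
        ENNReal.ofReal (ρ / (2 * (R ^ 2 - ρ ^ 2))) := by
  set B : Set (ℝ × ℝ) := {p | p.2 ∈ Icc (-γ) γ ∧ p.1 ∈ Ioc 0 (R * cos γ / cos p.2)} with hB
  have hBm : MeasurableSet B := by
    have h2 : MeasurableSet {p : ℝ × ℝ | 0 < p.1} := measurableSet_lt (by fun_prop) (by fun_prop)
    have h3 : MeasurableSet {p : ℝ × ℝ | p.1 ≤ R * cos γ / cos p.2} :=
      measurableSet_le (by fun_prop) (by fun_prop)
    convert (measurable_snd (measurableSet_Icc (a := -γ) (b := γ))).inter (h2.inter h3) using 1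
    ext; simp [hB]
  have hT : MeasurableSet polarCoord.target := polarCoord.open_target.measurableSet
  rw [← lintegral_indicator (measurableSet_isoscelesTriangle R γ),
    ← Complex.lintegral_comp_polarCoord_symm, ← lintegral_indicator hT,
    ← lintegral_indicator measurableSet_Icc]
  have key : ∀ p : ℝ × ℝ, polarCoord.target.indicator (fun p : ℝ × ℝ => ENNReal.ofReal p.1 •
      (isoscelesTriangle R γ).indicator
        (fun y : ℂ => ENNReal.ofReal (1 / (2 * (R ^ 2 - ‖y‖ ^ 2)))) (Complex.polarCoord.symm p)) p =
      B.indicator (fun p => ENNReal.ofReal (p.1 / (2 * (R ^ 2 - p.1 ^ 2)))) p := by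
    rintro ⟨ρ, φ⟩
    by_cases hp : (ρ, φ) ∈ polarCoord.target
    · have hp' : 0 < ρ ∧ φ ∈ Ioo (-π) π := by simpa [polarCoord_target] using hp
      have hiff : (ρ : ℂ) * (cos φ + sin φ * Complex.I) ∈ isoscelesTriangle R γ ↔ (ρ, φ) ∈ B := by
        rw [polar_mem_isoscelesTriangle_iff h0 h1 hp'.1 hp'.2]
        simp [hB, hp'.1]
      rw [indicator_of_mem hp, Complex.polarCoord_symm_apply]
      have hnorm := Complex.norm_polarCoord_symm (ρ, φ)
      rw [Complex.polarCoord_symm_apply] at hnorm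
      by_cases hb : (ρ, φ) ∈ B
      · rw [indicator_of_mem (hiff.2 hb), indicator_of_mem hb, smul_eq_mul,
          ← ENNReal.ofReal_mul hp'.1.le, hnorm, sq_abs, mul_one_div]
      · rw [indicator_of_notMem (mt hiff.1 hb), indicator_of_notMem hb, smul_zero]
    · rw [indicator_of_notMem hp, indicator_of_notMem]
      rintro ⟨h2, h3⟩
      refine hp ?_
      rw [polarCoord_target]
      exact ⟨h3.1, by linarith [h2.1], by linarith [h2.2]⟩
  rw [lintegral_congr key, Measure.volume_eq_prod,
    lintegral_prod_symm _ (Measurable.indicator (by fun_prop) hBm).aemeasurable]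
  refine lintegral_congr fun φ => ?_
  by_cases hφ : φ ∈ Icc (-γ) γ
  · rw [indicator_of_mem hφ, ← lintegral_indicator measurableSet_Ioc]
    refine lintegral_congr fun ρ => ?_
    simp only [indicator, hB, mem_ofPred_eq, hφ, true_and]
  · have : ∀ ρ, (ρ, φ) ∉ B := fun ρ hρ => hφ hρ.1
    rw [indicator_of_notMem hφ]
    simp only [indicator_of_notMem (this _), lintegral_zero]

theorem log_one_sub_div_cos_sq {R γ φ : ℝ} (hR : 0 < R) (h1 : γ < π / 2)
    (hφ : φ ∈ Ioo (-γ) γ) : R * cos γ / cos φ < R ∧ 0 ≤ R * cos γ / cos φ ∧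
      - (1 / 4) * log (1 - (R * cos γ / cos φ) ^ 2 / R ^ 2) =
        -(1 / 4) * (log (sin (γ - φ)) + log (sin (γ + φ)) - 2 * log (cos φ)) := by
  have hcosγ : 0 < cos γ := cos_pos_of_mem_Ioo ⟨by linarith [hφ.1, hφ.2, pi_pos], h1⟩
  have hc : 0 < cos φ := cos_pos_of_mem_Ioo ⟨by linarith [hφ.1], by linarith [hφ.2]⟩
  have hs1 : 0 < sin (γ - φ) :=
    sin_pos_of_pos_of_lt_pi (by linarith [hφ.2]) (by linarith [hφ.1])
  have hs2 : 0 < sin (γ + φ) :=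
    sin_pos_of_pos_of_lt_pi (by linarith [hφ.1]) (by linarith [hφ.2])
  have hid : cos φ ^ 2 - cos γ ^ 2 = sin (γ - φ) * sin (γ + φ) := by
    rw [sin_sub, sin_add]
    linear_combination (-(cos φ ^ 2)) * sin_sq_add_cos_sq γ + cos γ ^ 2 * sin_sq_add_cos_sq φ
  have hlt : cos γ < cos φ := by nlinarith [mul_pos hs1 hs2]
  refine ⟨by rw [div_lt_iff₀ hc]; nlinarith, by positivity, ?_⟩
  have : 1 - (R * cos γ / cos φ) ^ 2 / R ^ 2 = sin (γ - φ) * sin (γ + φ) / cos φ ^ 2 := by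
    rw [← hid]; field_simp
  rw [this, log_div (by positivity) (by positivity), log_mul hs1.ne' hs2.ne', log_pow]
  simp

theorem log_sin_sub_add_nonneg {γ φ : ℝ} (h1 : γ < π / 2) (hφ : φ ∈ Ioo (-γ) γ) :
    0 ≤ -(1 / 4) * (log (sin (γ - φ)) + log (sin (γ + φ)) - 2 * log (cos φ)) := by
  obtain ⟨h2, h3, h4⟩ := log_one_sub_div_cos_sq one_pos h1 hφ
  have h5 : (1 * cos γ / cos φ) ^ 2 / 1 ^ 2 < 1 := by
    rw [div_lt_one (by positivity)]; nlinarith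
  have h6 := log_nonpos (sub_nonneg.2 h5.le)
    (by linarith [show 0 ≤ (1 * cos γ / cos φ) ^ 2 / 1 ^ 2 by positivity])
  linarith

theorem integral_log_two_mul_sin_nonpos {γ : ℝ} (h0 : 0 ≤ γ) (h1 : γ < π / 2) :
    ∫ φ in (0 : ℝ)..γ, log (2 * sin φ) ≤ 0 := by
  have hle : -γ ≤ γ := by linarith
  rw [← neg_nonneg, ← integral_log_sin_sub_add h0 h1, intervalIntegral.integral_of_le hle,
    integral_Ioc_eq_integral_Ioo]
  exact setIntegral_nonneg measurableSet_Ioo fun φ hφ => log_sin_sub_add_nonneg h1 hφ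

theorem lintegral_isoscelesTriangle {R γ : ℝ} (hR : 0 < R) (h0 : 0 < γ) (h1 : γ < π / 2) :
    ∫⁻ y in isoscelesTriangle R γ, ENNReal.ofReal (1 / (2 * (R ^ 2 - ‖y‖ ^ 2))) =
      ENNReal.ofReal (- ∫ φ in (0 : ℝ)..γ, log (2 * sin φ)) := by
  set g : ℝ → ℝ := fun φ =>
    -(1 / 4) * (log (sin (γ - φ)) + log (sin (γ + φ)) - 2 * log (cos φ))
  have hgi : IntervalIntegrable g volume (-γ) γ :=
    (((intervalIntegrable_log_sin_sub γ).add (intervalIntegrable_log_sin_add γ)).sub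
      (intervalIntegrable_log_cos_apply.const_mul 2)).const_mul (-(1 / 4))
  have hle : -γ ≤ γ := by linarith
  rw [lintegral_isoscelesTriangle_eq_polar h0 h1, setLIntegral_congr Ioo_ae_eq_Icc.symm,
    setLIntegral_congr_fun (g := fun φ => ENNReal.ofReal (g φ)) measurableSet_Ioo
      (fun φ hφ => by
        obtain ⟨h2, h3, h4⟩ := log_one_sub_div_cos_sq hR h1 hφ
        simp only
        rw [lintegral_Ioc_div_sub_sq h3 h2, h4]),
    ← ofReal_integral_eq_lintegral_ofReal
      ((intervalIntegrable_iff_integrableOn_Ioo_of_le hle).1 hgi)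
      ((ae_restrict_iff' measurableSet_Ioo).2 (ae_of_all _ fun φ hφ =>
        log_sin_sub_add_nonneg h1 hφ)),
    ← integral_Ioc_eq_integral_Ioo, ← intervalIntegral.integral_of_le hle,
    integral_log_sin_sub_add h0.le h1]

theorem measurePreserving_add_mul (c : ℂ) {w : ℂ} (hw : ‖w‖ = 1) :
    MeasurePreserving (fun y : ℂ => c + w * y) := by
  have h1 := (rotation ⟨w, mem_sphere_zero_iff_norm.2 hw⟩).measurePreserving
  have h2 := measurePreserving_add_left (volume : Measure ℂ) c
  exact h2.comp h1

theorem mem_convexHull_iff_isoscelesTriangle {c p q w y : ℂ} {R γ : ℝ} (hR : 0 < R) (h0 : 0 < γ)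
    (h1 : γ < π / 2) (hw : w ≠ 0) (hp : p - c = R * w * (cos γ - sin γ * Complex.I))
    (hq : q - c = R * w * (cos γ + sin γ * Complex.I)) :
    c + w * y ∈ convexHull ℝ {c, p, q} ↔ y ∈ isoscelesTriangle R γ := by
  have hs : 0 < sin γ := sin_pos_of_pos_of_lt_pi h0 (by linarith)
  have hc : 0 < cos γ := cos_pos_of_mem_Ioo ⟨by linarith, h1⟩
  rw [mem_convexHull_triple, hp, hq]
  have key : ∀ a b : ℝ, c + w * y = c + (a • (R * w * (cos γ - sin γ * Complex.I)) +
      b • (R * w * (cos γ + sin γ * Complex.I))) ↔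
      y.re = R * (a + b) * cos γ ∧ y.im = R * (b - a) * sin γ := by
    intro a b
    rw [add_right_inj, Complex.real_smul, Complex.real_smul,
      show (a : ℂ) * (R * w * (cos γ - sin γ * Complex.I)) +
        b * (R * w * (cos γ + sin γ * Complex.I)) =
        w * ((R * (a + b) * cos γ : ℝ) + (R * (b - a) * sin γ : ℝ) * Complex.I) by
          push_cast; ring, mul_right_inj' hw, Complex.ext_iff]
    simp [-Complex.ofReal_cos, -Complex.ofReal_sin]
  simp only [key, mem_isoscelesTriangle]
  constructor
  · rintro ⟨a, b, ha, hb, hab, h2, h3⟩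
    rw [h2, h3]
    refine ⟨by nlinarith [mul_pos hR hc], ?_, ?_⟩
    · rw [show R * (a + b) * cos γ * sin γ - R * (b - a) * sin γ * cos γ =
        2 * R * a * (sin γ * cos γ) by ring]; positivity
    · rw [show R * (a + b) * cos γ * sin γ + R * (b - a) * sin γ * cos γ =
        2 * R * b * (sin γ * cos γ) by ring]; positivity
  · rintro ⟨h2, h3, h4⟩
    refine ⟨(y.re * sin γ - y.im * cos γ) / (2 * R * sin γ * cos γ),
      (y.re * sin γ + y.im * cos γ) / (2 * R * sin γ * cos γ), by positivity, by positivity,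
      ?_, ?_, ?_⟩
    · rw [← add_div, div_le_one (by positivity)]
      nlinarith
    · field_simp; ring
    · field_simp; ring

section Tetrahedron

variable {c p q z : ℂ} {R : ℝ}

theorem measurableSet_convexHull_triple : MeasurableSet (convexHull ℝ {c, p, q}) :=
  ((Set.toFinite {c, p, q}).isCompact_convexHull (𝕜 := ℝ)).isClosed.measurableSet

theorem convexHull_triple_subset_closedBall (hR : 0 < R) (hp : ‖p - c‖ = R) (hq : ‖q - c‖ = R) :
    convexHull ℝ {c, p, q} ⊆ Metric.closedBall c R := by
  refine convexHull_min ?_ (convex_closedBall c R)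
  rintro x (rfl | rfl | rfl)
  · exact Metric.mem_closedBall_self hR.le
  · exact mem_closedBall_iff_norm.2 hp.le
  · exact mem_closedBall_iff_norm.2 hq.le

theorem hyperbolicVolume_tetrahedron_of_im_pos (hR : 0 < R) (hp : ‖p - c‖ = R) (hz : ‖z‖ = 1)
    (hq : q - c = z * (p - c)) (him : 0 < z.im) :
    hyperbolicVolume {x | x.1 ∈ convexHull ℝ {c, p, q} ∧ R ^ 2 ≤ ‖x.1 - c‖ ^ 2 + x.2 ^ 2 ∧
      0 < x.2} = blochWigner z / 2 := by
  have hqR : ‖q - c‖ = R := by rw [hq, norm_mul, hz, one_mul, hp]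
  set γ := z.arg / 2 with hγ
  have hz0 : z ≠ 0 := by rintro rfl; simp at him
  have harg0 : 0 < z.arg := by
    refine lt_of_le_of_ne (Complex.arg_nonneg_iff.2 him.le) fun h => ?_
    exact him.ne' (Complex.arg_eq_zero_iff.1 h.symm).2
  have hargpi : z.arg < π := by
    refine lt_of_le_of_ne (Complex.arg_le_pi z) fun h => ?_
    exact him.ne' (Complex.arg_eq_pi_iff.1 h).2
  have h0 : 0 < γ := by positivity
  have h1 : γ < π / 2 := by linarith
  have hze : z = Complex.exp ((2 * γ : ℝ) * Complex.I) := by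
    have := Complex.norm_mul_exp_arg_mul_I z
    rw [hz, Complex.ofReal_one, one_mul] at this
    rw [hγ, mul_div_cancel₀ _ two_ne_zero, this]
  have hzs : z = (cos γ + sin γ * Complex.I) ^ 2 := by
    rw [hze, Complex.ofReal_cos, Complex.ofReal_sin, ← Complex.exp_mul_I, ← Complex.exp_nat_mul]
    congr 1; push_cast; ring
  have hcs : ((cos γ : ℂ) + sin γ * Complex.I) * (cos γ - sin γ * Complex.I) = 1 := by
    have h2 : ((sin γ : ℝ) : ℂ) ^ 2 + ((cos γ : ℝ) : ℂ) ^ 2 = 1 := by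
      exact_mod_cast sin_sq_add_cos_sq γ
    linear_combination h2 - ((sin γ : ℝ) : ℂ) ^ 2 * Complex.I_sq
  have hR' : (R : ℂ) ≠ 0 := by exact_mod_cast hR.ne'
  set w : ℂ := (p - c) / R * (cos γ + sin γ * Complex.I) with hw
  have hpw : p - c = R * w * (cos γ - sin γ * Complex.I) := by
    rw [hw, show (R : ℂ) * ((p - c) / R * (cos γ + sin γ * Complex.I)) *
      (cos γ - sin γ * Complex.I) = R * ((p - c) / R) *
      ((cos γ + sin γ * Complex.I) * (cos γ - sin γ * Complex.I)) by ring, hcs]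
    field_simp
  have hqw : q - c = R * w * (cos γ + sin γ * Complex.I) := by
    rw [hq, hzs, hw]; field_simp
  have hw1 : ‖w‖ = 1 := by
    have : ‖(cos γ : ℂ) + sin γ * Complex.I‖ = 1 := by
      rw [Complex.ofReal_cos, Complex.ofReal_sin, ← Complex.exp_mul_I,
        Complex.norm_exp_ofReal_mul_I]
    rw [hw, norm_mul, this, norm_div, hp, Complex.norm_real, norm_of_nonneg hR.le,
      div_self hR.ne', one_mul]
  have hw0 : w ≠ 0 := norm_pos_iff.1 (by rw [hw1]; norm_num)
  have hpre : (fun y : ℂ => c + w * y) ⁻¹' convexHull ℝ {c, p, q} = isoscelesTriangle R γ := by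
    ext y
    exact mem_convexHull_iff_isoscelesTriangle hR h0 h1 hw0 hpw hqw
  rw [hyperbolicVolume_above_hemisphere measurableSet_convexHull_triple
    (convexHull_triple_subset_closedBall hR hp hqR) hR.ne',
    ← (measurePreserving_add_mul c hw1).setLIntegral_comp_preimage
      measurableSet_convexHull_triple (by fun_prop), hpre]
  simp only [add_sub_cancel_left, norm_mul, hw1, one_mul]
  rw [lintegral_isoscelesTriangle hR h0 h1, hze, blochWigner_exp h0.le h1.le,
    ENNReal.toReal_ofReal]
  · ring
  · exact neg_nonneg.2 (integral_log_two_mul_sin_nonpos h0.le h1)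

theorem blochWigner_eq_zero_of_im_eq_zero (hz : ‖z‖ = 1) (him : z.im = 0) :
    blochWigner z = 0 := by
  have h := blochWigner_conj hz
  rw [Complex.conj_eq_iff_im.2 him] at h
  linarith

theorem hyperbolicVolume_tetrahedron_of_im_eq_zero (hR : 0 < R) (hp : ‖p - c‖ = R)
    (hz : ‖z‖ = 1) (hq : q - c = z * (p - c)) (him : z.im = 0) :
    hyperbolicVolume {x | x.1 ∈ convexHull ℝ {c, p, q} ∧ R ^ 2 ≤ ‖x.1 - c‖ ^ 2 + x.2 ^ 2 ∧
      0 < x.2} = 0 := by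
  have hqR : ‖q - c‖ = R := by rw [hq, norm_mul, hz, one_mul, hp]
  have hp0 : p - c ≠ 0 := norm_pos_iff.1 (by rw [hp]; exact hR)
  have hzr : z = (z.re : ℂ) := Complex.ext rfl (by simpa using him)
  set A : AffineSubspace ℝ ℂ := AffineSubspace.mk' c (Submodule.span ℝ {p - c})
  have hmem : ∀ y, y ∈ A ↔ ∃ s : ℝ, s • (p - c) = y - c := fun y => by
    rw [AffineSubspace.mem_mk', Submodule.mem_span_singleton, vsub_eq_sub]
  have hA : A ≠ ⊤ := by
    intro h
    obtain ⟨s, hs⟩ := (hmem (c + Complex.I * (p - c))).1 (h ▸ AffineSubspace.mem_top _ _ _)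
    rw [add_sub_cancel_left, Complex.real_smul, mul_left_inj' hp0] at hs
    simpa using congrArg Complex.im hs
  have hsub : convexHull ℝ {c, p, q} ⊆ (A : Set ℂ) := by
    refine convexHull_min ?_ A.convex
    rintro x (rfl | rfl | rfl)
    · exact (hmem _).2 ⟨0, by simp⟩
    · exact (hmem _).2 ⟨1, by simp⟩
    · exact (hmem _).2 ⟨z.re, by rw [Complex.real_smul, ← hzr, hq]⟩
  rw [hyperbolicVolume_above_hemisphere measurableSet_convexHull_triple
    (convexHull_triple_subset_closedBall hR hp hqR) hR.ne',
    setLIntegral_measure_zero _ _ (measure_mono_null hsub (Measure.addHaar_affineSubspace _ A hA))]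
  simp

theorem hyperbolicVolume_nonneg (A : Set (ℂ × ℝ)) : 0 ≤ hyperbolicVolume A :=
  ENNReal.toReal_nonneg

theorem blochWigner_nonneg (hz : ‖z‖ = 1) (him : 0 ≤ z.im) : 0 ≤ blochWigner z := by
  rcases him.eq_or_lt with h | h
  · exact (blochWigner_eq_zero_of_im_eq_zero hz h.symm).ge
  · have := hyperbolicVolume_tetrahedron_of_im_pos (c := 0) (p := 1) (q := z) one_pos (by simp) hz
      (by simp) h
    have h2 := (hyperbolicVolume_nonneg _).trans_eq this
    linarith

theorem blochWigner_nonpos (hz : ‖z‖ = 1) (him : z.im ≤ 0) : blochWigner z ≤ 0 := by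
  have h := blochWigner_nonneg (z := starRingEnd ℂ z) (by rwa [Complex.norm_conj])
    (by rw [Complex.conj_im]; linarith)
  rw [blochWigner_conj hz] at h
  linarith

theorem hyperbolicVolume_tetrahedron (hR : 0 < R) (hp : ‖p - c‖ = R) (hz : ‖z‖ = 1)
    (hq : q - c = z * (p - c)) :
    hyperbolicVolume {x | x.1 ∈ convexHull ℝ {c, p, q} ∧ R ^ 2 ≤ ‖x.1 - c‖ ^ 2 + x.2 ^ 2 ∧
      0 < x.2} = |blochWigner z| / 2 := by
  rcases lt_trichotomy z.im 0 with h | h | h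
  · have hz0 : z ≠ 0 := by rintro rfl; simp at h
    have hc : starRingEnd ℂ z = z⁻¹ := (Complex.inv_eq_conj hz).symm
    have := hyperbolicVolume_tetrahedron_of_im_pos (c := c) (p := q) (q := p)
      (z := starRingEnd ℂ z) hR (by rw [hq, norm_mul, hz, one_mul, hp])
      (by rwa [Complex.norm_conj])
      (by rw [hc, hq, inv_mul_cancel_left₀ hz0]) (by rw [Complex.conj_im]; linarith)
    rw [blochWigner_conj hz] at this
    rw [Set.pair_comm p q, this, abs_of_nonpos (blochWigner_nonpos hz h.le)]
  · rw [hyperbolicVolume_tetrahedron_of_im_eq_zero hR hp hz hq h,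
      blochWigner_eq_zero_of_im_eq_zero hz h]
    simp
  · rw [hyperbolicVolume_tetrahedron_of_im_pos hR hp hz hq h,
      abs_of_nonneg (blochWigner_nonneg hz h.le)]

end Tetrahedron

namespace AdmissiblePolygon

variable {m n : ℕ} {t : ℝ} (P : AdmissiblePolygon m n t)

theorem hyperbolicVolume_tetrahedron (i : Fin (m + n)) :
    hyperbolicVolume (P.tetrahedron i) = |blochWigner (P.turn i)| / 2 :=
  _root_.hyperbolicVolume_tetrahedron P.radius_pos (P.cyclic i) (P.norm_turn i)
    (by rw [turn, sideTurn, div_mul_cancel₀ _ (P.vertex_sub_ne_zero i)])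

theorem two_mul_polyhedronVolume {u v : ℂ} (hm : 0 < m) (hn : 0 < n)
    (hu : ∀ i ∈ P.longSides, P.turn i = u) (hv : ∀ j ∉ P.longSides, P.turn j = v) :
    2 * P.polyhedronVolume = m * blochWigner u + n * blochWigner v ∨
      2 * P.polyhedronVolume = -(m * blochWigner u + n * blochWigner v) := by
  obtain ⟨i, hi⟩ := P.exists_mem_longSides hm
  obtain ⟨j, hj⟩ := P.exists_notMem_longSides hn
  have hu1 : ‖u‖ = 1 := hu i hi ▸ P.norm_turn i
  have hv1 : ‖v‖ = 1 := hv j hj ▸ P.norm_turn j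
  have hopp : P.OppositeDirections ↔ u.im * v.im < 0 := by
    constructor
    · rintro ⟨i, hi, j, hj, h⟩
      rwa [hu i hi, hv j hj] at h
    · intro h
      exact ⟨i, hi, j, hj, by rwa [hu i hi, hv j hj]⟩
  rw [polyhedronVolume,
    Finset.sum_congr rfl fun k hk => by
      rw [P.hyperbolicVolume_tetrahedron, hv k (Finset.mem_compl.1 hk)],
    Finset.sum_congr (s₁ := P.longSides) rfl fun k hk => by
      rw [P.hyperbolicVolume_tetrahedron, hu k hk],
    Finset.sum_const, Finset.sum_const, P.card_long, P.card_compl_longSides, nsmul_eq_mul,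
    nsmul_eq_mul]
  split_ifs with h
  · rcases mul_neg_iff.1 (hopp.1 h) with ⟨h1, h2⟩ | ⟨h1, h2⟩
    · rw [abs_of_nonneg (blochWigner_nonneg hu1 h1.le), abs_of_nonpos (blochWigner_nonpos hv1 h2.le)]
      right; ring
    · rw [abs_of_nonpos (blochWigner_nonpos hu1 h1.le), abs_of_nonneg (blochWigner_nonneg hv1 h2.le)]
      left; ring
  · rw [hopp, not_lt] at h
    rcases mul_nonneg_iff.1 h with ⟨h1, h2⟩ | ⟨h1, h2⟩
    · rw [abs_of_nonneg (blochWigner_nonneg hu1 h1), abs_of_nonneg (blochWigner_nonneg hv1 h2)]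
      left; ring
    · rw [abs_of_nonpos (blochWigner_nonpos hu1 h1), abs_of_nonpos (blochWigner_nonpos hv1 h2)]
      right; ring

variable {P} in
theorem CorrespondsTo.exists_sign {x : ℂ} (hm : 0 < m) (hn : 0 < n) (hx : ‖x‖ = 1)
    (h : P.CorrespondsTo x) : ∃ δ : ℝ, (δ = 1 ∨ δ = -1) ∧
      δ * (2 * P.polyhedronVolume) = m * blochWigner (x ^ n) - n * blochWigner (x ^ m) := by
  have hinv : ∀ k : ℕ, blochWigner (x ^ k)⁻¹ = - blochWigner (x ^ k) := fun k => by
    have hk : ‖x ^ k‖ = 1 := by rw [norm_pow, hx, one_pow]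
    rw [Complex.inv_eq_conj hk, blochWigner_conj hk]
  rcases h with ⟨h1, h2⟩ | ⟨h1, h2⟩ <;>
    rcases P.two_mul_polyhedronVolume hm hn h2 h1 with h | h <;> rw [hinv] at h
  · exact ⟨-1, Or.inr rfl, by rw [h]; ring⟩
  · exact ⟨1, Or.inl rfl, by rw [h]; ring⟩
  · exact ⟨1, Or.inl rfl, by rw [h]; ring⟩
  · exact ⟨-1, Or.inr rfl, by rw [h]; ring⟩

end AdmissiblePolygon

end

theorem sum_fin_comp_eq {ι : Type*} {N M : ℕ} {S : Set ι} (α : Fin N → ι) (hα : Function.Injective α)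
    (Φ : S ≃ Fin M) (hS : ∀ k, α k ∈ S) (f : Fin M → ℝ)
    (hf : ∀ x : S, (x : ι) ∉ Set.range α → f (Φ x) = 0) :
    ∑ k : Fin N, f (Φ ⟨α k, hS k⟩) = ∑ k : Fin M, f k := by
  have hinj : Function.Injective fun k => Φ ⟨α k, hS k⟩ := fun a b h =>
    hα (congrArg Subtype.val (Φ.injective h))
  rw [← Finset.sum_image (f := f) hinj.injOn]
  refine Finset.sum_subset (Finset.subset_univ _) fun k _ hk => ?_
  obtain ⟨x, rfl⟩ := Φ.surjective k
  refine hf x ?_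
  rintro ⟨j, hj⟩
  exact hk (Finset.mem_image.2 ⟨j, Finset.mem_univ j, congrArg Φ (Subtype.ext hj)⟩)

theorem theorem2 (m n : ℕ) (hm : 0 < m) (hn : 0 < n) (hmn : Nat.Coprime m n)
    (t : ℝ) (ht : 0 < t) (hne : ¬ (m = 1 ∧ n = 1 ∧ t = 1)) :
    -- finitely many roots and finitely many admissible polygons
    (upperUnitRoots m n t).Finite ∧
    Finite (Quotient (AdmissiblePolygon.setoid m n t)) ∧
    -- for the list `α` of the roots of odd multiplicity in counterclockwise order, and any list `P`
    -- of all the admissible polygons, each of them once: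
    ∀ (N : ℕ) (α : Fin N → ℂ) (M : ℕ) (P : Fin M → AdmissiblePolygon m n t),
      StrictMono (fun k => Complex.arg (α k)) →
      Set.range α = oddUpperUnitRoots m n t →
      (∀ X : AdmissiblePolygon m n t, ∃! k : Fin M, X.Equivalent (P k)) →
      -- the bijection between roots and polygons, with the value of the volume
      ∃ Φ : upperUnitRoots m n t ≃ Fin M,
        (∀ x : upperUnitRoots m n t, (P (Φ x)).CorrespondsTo (x : ℂ)) ∧
        (∀ x : upperUnitRoots m n t, ∃ δ : ℝ, (δ = 1 ∨ δ = -1) ∧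
          δ * (2 * (P (Φ x)).polyhedronVolume) =
            m * blochWigner ((x : ℂ) ^ n) - n * blochWigner ((x : ℂ) ^ m)) ∧
        -- the identity of the dilogarithm sum and the sum of volumes
        ∀ ε : ℝ, (ε = 1 ∨ ε = -1) →
          ∃ ε' : Fin M → ℝ,
            (∀ x : upperUnitRoots m n t,
              ((x : ℂ) ∈ oddUpperUnitRoots m n t → ε' (Φ x) = 1 ∨ ε' (Φ x) = -1) ∧
              ((x : ℂ) ∉ oddUpperUnitRoots m n t → ε' (Φ x) = 0)) ∧
            ε * ∑ k : Fin N, (-1 : ℝ) ^ ((k : ℕ) + 1) *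
                (blochWigner (α k ^ n) / n - blochWigner (α k ^ m) / m) =
              2 / ((m : ℝ) * n) * ∑ k : Fin M, ε' k * (P k).polyhedronVolume := by

  refine ⟨finite_upperUnitRoots hm hn hmn ht hne,
    AdmissiblePolygon.finite_quotient hm hn hmn ht hne, ?_⟩
  intro N α M P hmono hrange hP
  choose F hF using fun x : upperUnitRoots m n t =>
    AdmissiblePolygon.exists_of_mem_upperUnitRoots hm hn hmn ht hne x.2
  choose κ hκ hκ' using hP
  have hFk : ∀ x, (P (κ (F x))).CorrespondsTo (x : ℂ) := fun x =>
    (hF x).of_equivalent x.2.1 (hκ (F x))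
  have hinj : Function.Injective fun x => κ (F x) := by
    intro x y hxy
    have hy := hFk y
    simp only at hxy
    rw [← hxy] at hy
    exact Subtype.ext ((hFk x).unique hm hn hmn x.2 y.2 hy)
  have hsurj : Function.Surjective fun x => κ (F x) := by
    intro k
    obtain ⟨x, hx, hkx⟩ := (P k).exists_correspondsTo hm hn hmn ht
    refine ⟨⟨x, hx⟩, ?_⟩
    have h1 : (P k).Equivalent (P (κ (F ⟨x, hx⟩))) := hkx.equivalent hn hx.1 (hFk ⟨x, hx⟩)
    exact (hκ' _ _ h1).trans (hκ' _ _ (AdmissiblePolygon.equivalent_equivalence.refl (P k))).symm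
  choose δ hδ hvol using fun x => (hFk x).exists_sign hm hn x.2.1
  refine ⟨Equiv.ofBijective _ ⟨hinj, hsurj⟩, hFk, fun x => ⟨δ x, hδ x, hvol x⟩, ?_⟩
  set Φ : upperUnitRoots m n t ≃ Fin M := Equiv.ofBijective _ ⟨hinj, hsurj⟩
  intro ε hε
  have hαinj : Function.Injective α := fun a b h => hmono.injective (congrArg Complex.arg h)
  have hαodd : ∀ k, α k ∈ oddUpperUnitRoots m n t := fun k => hrange ▸ Set.mem_range_self k
  have hα : ∀ k, α k ∈ upperUnitRoots m n t := fun k => (hαodd k).1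
  classical
  let s : upperUnitRoots m n t → ℝ := fun x =>
    if h : ∃ k, α k = x then ε * (-1) ^ ((h.choose : ℕ) + 1) * δ x else 0
  have hs : ∀ k, s ⟨α k, hα k⟩ = ε * (-1) ^ ((k : ℕ) + 1) * δ ⟨α k, hα k⟩ := by
    intro k
    have h : ∃ j, α j = α k := ⟨k, rfl⟩
    have hc : h.choose = k := hαinj h.choose_spec
    simp only [s, dif_pos h, hc]
  have hs0 : ∀ x : upperUnitRoots m n t, (x : ℂ) ∉ oddUpperUnitRoots m n t → s x = 0 := by
    intro x hx
    rw [← hrange] at hx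
    exact dif_neg fun ⟨k, hk⟩ => hx ⟨k, hk⟩
  refine ⟨fun k => s (Φ.symm k), fun x => ⟨fun hx => ?_, fun hx => ?_⟩, ?_⟩
  · rw [← hrange] at hx
    obtain ⟨k, hk⟩ := hx
    obtain rfl : x = ⟨α k, hα k⟩ := Subtype.ext hk.symm
    simp only [Equiv.symm_apply_apply]
    rw [hs]
    rcases hε with rfl | rfl <;> rcases hδ ⟨α k, hα k⟩ with h | h <;>
      rcases neg_one_pow_eq_or ℝ ((k : ℕ) + 1) with h' | h' <;> rw [h, h'] <;> norm_num
  · simp only [Equiv.symm_apply_apply]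
    exact hs0 x hx
  · rw [← sum_fin_comp_eq α hαinj Φ hα _ fun x hx => by
      simp only [Equiv.symm_apply_apply]
      rw [hs0 x (hrange ▸ hx), zero_mul], Finset.mul_sum, Finset.mul_sum]
    refine Finset.sum_congr rfl fun k _ => ?_
    have hv := hvol ⟨α k, hα k⟩
    have hm' : (m : ℝ) ≠ 0 := by positivity
    have hn' : (n : ℝ) ≠ 0 := by positivity
    simp only [Equiv.symm_apply_apply]
    rw [hs]
    have hdiv : blochWigner (α k ^ n) / n - blochWigner (α k ^ m) / m =
        (δ ⟨α k, hα k⟩ * (2 * (P (Φ ⟨α k, hα k⟩)).polyhedronVolume)) / (m * n) := by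
      rw [show Φ ⟨α k, hα k⟩ = κ (F ⟨α k, hα k⟩) from rfl, hv]
      field_simp
    rw [hdiv]
    field_simp
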